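/- **The system $\lambda^{\Pi\text{и}}$.** Fix countably infinite, disjoint sets of variables $x$, names $\mathsf a,\mathsf b$, object constants $c$, type constants $a$ and name-type constants $\alpha$. Kinds, type families and objects, up to renaming of bound variables and names, are $$K ::= \mathrm{type}\mid \Pi x{:}A.K,\qquad A,B ::= a\mid A\,M\mid \Pi x{:}A.B\mid \alpha\mid \text{и}\mathsf a{:}\alpha.B,$$ $$M,N ::= c\mid x\mid \lambda x{:}A.M\mid M\,N\mid \mathsf a\mid \langle \mathsf a{:}\alpha\rangle M\mid M@\mathsf a,$$ where $\text{и}\mathsf a{:}\alpha.B$ and $\langle\mathsf a{:}\alpha\rangle M$ bind $\mathsf a$. Signatures $\Sigma$ are lists of declarations $a{:}K$, $c{:}A$, $\alpha{:}\mathrm{name}$, and contexts are $\Gamma::=\cdot\mid\Gamma,x{:}A\mid\Gamma\#\mathsf a{:}\alpha$; the symbols declared are distinct. A signature is well-formed if each declared $K$ is a kind, and each declared $A$ a type, in the empty context over the preceding declarations. A context is well-formed if each $x{:}A$ in it has $A:\mathrm{type}$ in the preceding context, and each $\#\mathsf a{:}\alpha$ has $\alpha{:}\mathrm{name}\in\Sigma$.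 In all judgments $\Gamma\vdash\mathcal J$, $\Sigma$ and $\Gamma$ are presupposed well-formed; in rules that extend the context, the declared variable or name is fresh, and the well-formedness of the extended context is a tacit premise. *Restriction* $\Gamma-\mathsf a{:}\alpha=\Gamma'$ removes from $\Gamma$ the name $\mathsf a{:}\alpha$ and all variables (but not the names) declared after it: $(\Gamma\#\mathsf a{:}\alpha)-\mathsf a{:}\alpha=\Gamma$; and if $\Gamma-\mathsf a{:}\alpha=\Gamma'$ then $(\Gamma\#\mathsf b{:}\beta)-\mathsf a{:}\alpha=\Gamma'\#\mathsf b{:}\beta$ for $\mathsf b\ne\mathsf a$, and $(\Gamma,x{:}A)-\mathsf a{:}\alpha=\Gamma'$. *Typing.* Kinds: $\mathrm{type}$; $\Pi x{:}A.K$ if $A:\mathrm{type}$ and $\Gamma,x{:}A\vdash K:\mathrm{kind}$. Types: $a:K$ if $a{:}K\in\Sigma$; $A\,M:K[M/x]$ if $A:\Pi x{:}B.K$ and $M:B$; $\Pi x{:}A.B:\mathrm{type}$ if $A:\mathrm{type}$ and $\Gamma,x{:}A\vdash B:\mathrm{type}$; $\alpha:\mathrm{type}$ if $\alpha{:}\mathrm{name}\in\Sigma$;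 $\text{и}\mathsf a{:}\alpha.B:\mathrm{type}$ if $\alpha{:}\mathrm{name}\in\Sigma$ and $\Gamma\#\mathsf a{:}\alpha\vdash B:\mathrm{type}$; conversion along kind equality. Objects: $c$, $x$, $\mathsf a$ have their declared types; $\lambda x{:}A.M:\Pi x{:}A.B$ if $A:\mathrm{type}$ and $\Gamma,x{:}A\vdash M:B$; $M\,N:B[N/x]$ if $M:\Pi x{:}A.B$ and $N:A$; $\langle\mathsf a{:}\alpha\rangle M:\text{и}\mathsf a{:}\alpha.B$ if $\alpha{:}\mathrm{name}\in\Sigma$ and $\Gamma\#\mathsf a{:}\alpha\vdash M:B$; $M@\mathsf b:B[\mathsf b/\mathsf a]$ if $\Gamma-\mathsf b{:}\alpha=\Gamma'$ and $\Gamma'\vdash M:\text{и}\mathsf a{:}\alpha.B$; conversion along equality of types of kind $\mathrm{type}$. *Definitional equality* of kinds, of types at a kind, and of objects at a type is given by symmetry, transitivity, conversion, congruence for every constructor (including $\alpha=\alpha:\mathrm{type}$ for declared $\alpha$, and, for concretion, $\Gamma\vdash M@\mathsf b=N@\mathsf b:A[\mathsf b/\mathsf a]$ if $\Gamma-\mathsf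 b{:}\alpha=\Gamma'$ and $\Gamma'\vdash M=N:\text{и}\mathsf a{:}\alpha.A$; for $\Pi$, congruence has the premise that the first domain is a type, and for $\lambda$ the two domain annotations are each equal to the type $A$ of the bound variable), and the following rules. - $(\lambda x{:}A.M)\,M_1=N[N_1/x]:B[M_1/x]$ if $A:\mathrm{type}$, $\Gamma,x{:}A\vdash M=N:B$ and $M_1=N_1:A$. - $M=N:\Pi x{:}A.B$ if $A:\mathrm{type}$, $M,N:\Pi x{:}A.B$ and $\Gamma,x{:}A\vdash M\,x=N\,x:B$. - $A_1=A_2:\Pi x{:}B.K$ if $\Gamma,x{:}B\vdash A_1\,x=A_2\,x:K$. - $(\langle\mathsf a{:}\alpha\rangle M)@\mathsf b=N[\mathsf b/\mathsf a]:A[\mathsf b/\mathsf a]$ if $\Gamma-\mathsf b{:}\alpha=\Gamma'$ and $\Gamma'\#\mathsf a{:}\alpha\vdash M=N:A$. - $M=N:\text{и}\mathsf a{:}\alpha.A$ if $\Gamma\#\mathsf a{:}\alpha\vdash M@\mathsf a=N@\mathsf a:A$. *Weak head reduction* $\to$ is the least relation on objects with $(\lambda x{:}A.M)\,N\to M[N/x]$,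 $(\langle\mathsf a{:}\alpha\rangle M)@\mathsf b\to M[\mathsf b/\mathsf a]$, and, whenever $M\to M'$, $M\,N\to M'\,N$ and $M@\mathsf a\to M'@\mathsf a$. **Theorem (Subject reduction).** Let $\Sigma$ be a well-formed signature and $\Gamma$ a well-formed context over $\Sigma$. If $\Gamma\vdash M:A$ and $M\to M'$, then $\Gamma\vdash M=M':A$ and $\Gamma\vdash M':A$. -/

import Mathlib

/-!
# The dependent nominal type theory `λ^{Πи}`: LF extended with names and name-abstraction types

Syntax is locally nameless, so that `α`-equivalent expressions are equal.  Free variables and free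
names are atoms; bound variables and bound names are de Bruijn indices, *counted separately*:
a bound variable refers to the enclosing `Π`/`λ` binders, a bound name refers to the enclosing
`и`/`⟨a:α⟩` binders.  In the binding rules, premises about a body opened with a fresh atom are
quantified cofinitely.
-/

namespace NomLF

/-- Variables `x, y`. -/
abbrev Var := ℕ
/-- Names (as atoms). -/
abbrev Name := ℕ
/-- Object constants `c, d`. -/
abbrev ObjConst := ℕ
/-- Type family constants `a, b`. -/
abbrev FamConst := ℕ
/-- Name-type constants `α, β`. -/
abbrev NameType := ℕ

/-- Occurrence of a name in an expression: bound (de Bruijn index) or free. -/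
inductive NameRef : Type
  | bound (i : ℕ)
  | free (a : Name)

/-- The three syntactic classes. -/
inductive Cls : Type
  | kind
  | fam
  | obj

/-- Kinds, type families and objects. -/
inductive Exp : Cls → Type
  /-- the kind `type` -/
  | type : Exp .kind
  /-- the kind `Πx:A.K`; binds a variable in `K` -/
  | piK (A : Exp .fam) (K : Exp .kind) : Exp .kind
  /-- a type constant -/
  | famConst (a : FamConst) : Exp .fam
  /-- the type family `A M` -/
  | famApp (A : Exp .fam) (M : Exp .obj) : Exp .fam
  /-- the type `Πx:A.B`; binds a variable in `B` -/
  | pi (A B : Exp .fam) : Exp .fam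
  /-- a name-type -/
  | nameType (α : NameType) : Exp .fam
  /-- the name-abstraction type `иa:α.B`; binds a name in `B` -/
  | new (α : NameType) (B : Exp .fam) : Exp .fam
  /-- an object constant -/
  | objConst (c : ObjConst) : Exp .obj
  /-- a bound variable -/
  | bvar (i : ℕ) : Exp .obj
  /-- a free variable -/
  | fvar (x : Var) : Exp .obj
  /-- `λx:A.M`; binds a variable in `M` -/
  | lam (A : Exp .fam) (M : Exp .obj) : Exp .obj
  /-- the application `M N` -/
  | app (M N : Exp .obj) : Exp .obj
  /-- a name used as an object -/
  | name (a : NameRef) : Exp .obj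
  /-- the name-abstraction `⟨a:α⟩M`; binds a name in `M` -/
  | abs (α : NameType) (M : Exp .obj) : Exp .obj
  /-- the concretion `M @ a` -/
  | conc (M : Exp .obj) (a : NameRef) : Exp .obj

abbrev Kd := Exp .kind
abbrev Ty := Exp .fam
abbrev Tm := Exp .obj

namespace Exp

/-- Replace the bound variable of index `k` by `u`. The expression `openVarAt N 0 e` is `e[N/x]`
where `x` is the variable bound immediately outside `e` (`N` has no dangling indices in any
derivable use, so that no capture can occur). -/
def openVarAt (u : Tm) : {c : Cls} → ℕ → Exp c → Exp c
  | _, _, .type => .type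
  | _, k, .piK A K => .piK (openVarAt u k A) (openVarAt u (k + 1) K)
  | _, _, .famConst a => .famConst a
  | _, k, .famApp A M => .famApp (openVarAt u k A) (openVarAt u k M)
  | _, k, .pi A B => .pi (openVarAt u k A) (openVarAt u (k + 1) B)
  | _, _, .nameType α => .nameType α
  | _, k, .new α B => .new α (openVarAt u k B)
  | _, _, .objConst c => .objConst c
  | _, k, .bvar i => if i = k then u else .bvar i
  | _, _, .fvar x => .fvar x
  | _, k, .lam A M => .lam (openVarAt u k A) (openVarAt u (k + 1) M)
  | _, k, .app M N => .app (openVarAt u k M) (openVarAt u k N)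
  | _, _, .name a => .name a
  | _, k, .abs α M => .abs α (openVarAt u k M)
  | _, k, .conc M a => .conc (openVarAt u k M) a

end Exp

/-- Replace the bound name of index `k` by the free name `b` in a name occurrence. -/
def NameRef.openAt (b : Name) (k : ℕ) : NameRef → NameRef
  | .bound i => if i = k then .free b else .bound i
  | .free a => .free a

namespace Exp

/-- Replace the bound name of index `k` by the free name `b`. The expression `openNameAt b 0 e`
is `e[b/a]` where `a` is the name bound immediately outside `e`. -/
def openNameAt (b : Name) : {c : Cls} → ℕ → Exp c → Exp c
  | _, _, .type => .type
  | _, k, .piK A K => .piK (openNameAt b k A) (openNameAt b k K)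
  | _, _, .famConst a => .famConst a
  | _, k, .famApp A M => .famApp (openNameAt b k A) (openNameAt b k M)
  | _, k, .pi A B => .pi (openNameAt b k A) (openNameAt b k B)
  | _, _, .nameType α => .nameType α
  | _, k, .new α B => .new α (openNameAt b (k + 1) B)
  | _, _, .objConst c => .objConst c
  | _, _, .bvar i => .bvar i
  | _, _, .fvar x => .fvar x
  | _, k, .lam A M => .lam (openNameAt b k A) (openNameAt b k M)
  | _, k, .app M N => .app (openNameAt b k M) (openNameAt b k N)
  | _, k, .name a => .name (a.openAt b k)
  | _, k, .abs α M => .abs α (openNameAt b (k + 1) M)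
  | _, k, .conc M a => .conc (openNameAt b k M) (a.openAt b k)

/-- `e[N/x]`, for the body `e` of a binder of the variable `x`. -/
abbrev inst {c : Cls} (e : Exp c) (N : Tm) : Exp c := openVarAt N 0 e

/-- `e[b/a]`, for the body `e` of a binder of the name `a`. -/
abbrev instName {c : Cls} (e : Exp c) (b : Name) : Exp c := openNameAt b 0 e

end Exp

/-! ### Signatures and contexts -/

/-- Declarations `a:K`, `c:A`, `α:name` of a signature. -/
inductive SigDecl : Type
  | fam (a : FamConst) (K : Kd)
  | obj (c : ObjConst) (A : Ty)
  | name (α : NameType)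

/-- Signatures; the most recent declaration is the head of the list. -/
abbrev Sig := List SigDecl

/-- Context entries `x:A` and `#a:α`. -/
inductive Entry : Type
  | var (x : Var) (A : Ty)
  | name (a : Name) (α : NameType)

/-- Contexts; the most recent entry is the head of the list, so `Γ, x:A` is `.var x A :: Γ` and
`Γ # a:α` is `.name a α :: Γ`. -/
abbrev Ctx := List Entry

/-- Context restriction `Γ - a:α = Γ'`: remove the name `a` and all variables (but not the names)
that were introduced more recently than `a`. -/
inductive Restrict : Ctx → Name → NameType → Ctx → Prop
  | id (Γ : Ctx) (a : Name) (α : NameType) : Restrict (.name a α :: Γ) a α Γ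
  | nm {Γ Γ' : Ctx} {a : Name} {α : NameType} (b : Name) (β : NameType) (hab : b ≠ a)
      (h : Restrict Γ a α Γ') : Restrict (.name b β :: Γ) a α (.name b β :: Γ')
  | var {Γ Γ' : Ctx} {a : Name} {α : NameType} (x : Var) (A : Ty)
      (h : Restrict Γ a α Γ') : Restrict (.var x A :: Γ) a α Γ'

/-! ### Typing and definitional equality -/

/-- The six judgment forms `K : kind`, `A : K`, `M : A`, `K = K' : kind`, `A = A' : K`,
`M = M' : A`. -/
inductive Judgment : Type
  | kind (K : Kd)
  | fam (A : Ty) (K : Kd)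
  | obj (M : Tm) (A : Ty)
  | kindEq (K K' : Kd)
  | famEq (A A' : Ty) (K : Kd)
  | objEq (M M' : Tm) (A : Ty)

/-- `Derives S Γ J` is the judgment `Γ ⊢_S J`. Well-formedness of `S` and `Γ` is presupposed, and
every rule that extends the context has premises that keep it well-formed. -/
inductive Derives (S : Sig) : Ctx → Judgment → Prop
  -- kinds
  | type_k {Γ : Ctx} : Derives S Γ (.kind .type)
  | pi_k {Γ : Ctx} {A : Ty} {K : Kd} (L : Finset Var)
      (hA : Derives S Γ (.fam A .type))
      (hK : ∀ x ∉ L, Derives S (.var x A :: Γ) (.kind (K.inst (.fvar x)))) :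
      Derives S Γ (.kind (.piK A K))
  -- type families
  | con_t {Γ : Ctx} {a : FamConst} {K : Kd} (ha : SigDecl.fam a K ∈ S) :
      Derives S Γ (.fam (.famConst a) K)
  | app_t {Γ : Ctx} {A B : Ty} {K : Kd} {M : Tm}
      (hA : Derives S Γ (.fam A (.piK B K)))
      (hM : Derives S Γ (.obj M B)) :
      Derives S Γ (.fam (.famApp A M) (K.inst M))
  | pi_t {Γ : Ctx} {A B : Ty} (L : Finset Var)
      (hA : Derives S Γ (.fam A .type))
      (hB : ∀ x ∉ L, Derives S (.var x A :: Γ) (.fam (B.inst (.fvar x)) .type)) :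
      Derives S Γ (.fam (.pi A B) .type)
  | conv_t {Γ : Ctx} {A : Ty} {K K' : Kd}
      (hA : Derives S Γ (.fam A K'))
      (hK : Derives S Γ (.kindEq K K')) :
      Derives S Γ (.fam A K)
  | nm_t {Γ : Ctx} {α : NameType} (hα : SigDecl.name α ∈ S) :
      Derives S Γ (.fam (.nameType α) .type)
  | new_t {Γ : Ctx} {α : NameType} {B : Ty} (L : Finset Name) (hα : SigDecl.name α ∈ S)
      (hB : ∀ a ∉ L, Derives S (.name a α :: Γ) (.fam (B.instName a) .type)) :
      Derives S Γ (.fam (.new α B) .type)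
  -- objects
  | con_o {Γ : Ctx} {c : ObjConst} {A : Ty} (hc : SigDecl.obj c A ∈ S) :
      Derives S Γ (.obj (.objConst c) A)
  | var_o {Γ : Ctx} {x : Var} {A : Ty} (hx : Entry.var x A ∈ Γ) :
      Derives S Γ (.obj (.fvar x) A)
  | nm_o {Γ : Ctx} {a : Name} {α : NameType} (ha : Entry.name a α ∈ Γ) :
      Derives S Γ (.obj (.name (.free a)) (.nameType α))
  | lam_o {Γ : Ctx} {A B : Ty} {M : Tm} (L : Finset Var)
      (hA : Derives S Γ (.fam A .type))
      (hM : ∀ x ∉ L, Derives S (.var x A :: Γ)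
        (.obj (M.inst (.fvar x)) (B.inst (.fvar x)))) :
      Derives S Γ (.obj (.lam A M) (.pi A B))
  | app_o {Γ : Ctx} {A B : Ty} {M N : Tm}
      (hM : Derives S Γ (.obj M (.pi A B)))
      (hN : Derives S Γ (.obj N A)) :
      Derives S Γ (.obj (.app M N) (B.inst N))
  | abs_o {Γ : Ctx} {α : NameType} {B : Ty} {M : Tm} (L : Finset Name)
      (hα : SigDecl.name α ∈ S)
      (hM : ∀ a ∉ L, Derives S (.name a α :: Γ) (.obj (M.instName a) (B.instName a))) :
      Derives S Γ (.obj (.abs α M) (.new α B))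
  | conc_o {Γ Γ' : Ctx} {b : Name} {α : NameType} {B : Ty} {M : Tm}
      (hr : Restrict Γ b α Γ')
      (hM : Derives S Γ' (.obj M (.new α B))) :
      Derives S Γ (.obj (.conc M (.free b)) (B.instName b))
  | conv_o {Γ : Ctx} {A B : Ty} {M : Tm}
      (hM : Derives S Γ (.obj M A))
      (hAB : Derives S Γ (.famEq A B .type)) :
      Derives S Γ (.obj M B)
  -- equality of kinds
  | eq_type_k {Γ : Ctx} : Derives S Γ (.kindEq .type .type)
  | eq_pi_k {Γ : Ctx} {A B : Ty} {K K' : Kd} (L : Finset Var)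
      (hAB : Derives S Γ (.famEq A B .type))
      (hA : Derives S Γ (.fam A .type))
      (hK : ∀ x ∉ L, Derives S (.var x A :: Γ)
        (.kindEq (K.inst (.fvar x)) (K'.inst (.fvar x)))) :
      Derives S Γ (.kindEq (.piK A K) (.piK B K'))
  | eq_symm_k {Γ : Ctx} {K K' : Kd} (h : Derives S Γ (.kindEq K K')) :
      Derives S Γ (.kindEq K' K)
  | eq_trans_k {Γ : Ctx} {K₁ K₂ K₃ : Kd}
      (h₁ : Derives S Γ (.kindEq K₁ K₂)) (h₂ : Derives S Γ (.kindEq K₂ K₃)) :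
      Derives S Γ (.kindEq K₁ K₃)
  -- equality of type families
  | eq_con_t {Γ : Ctx} {a : FamConst} {K : Kd} (ha : SigDecl.fam a K ∈ S) :
      Derives S Γ (.famEq (.famConst a) (.famConst a) K)
  | eq_app_t {Γ : Ctx} {A B C : Ty} {K : Kd} {M N : Tm}
      (hA : Derives S Γ (.famEq A B (.piK C K)))
      (hM : Derives S Γ (.objEq M N C)) :
      Derives S Γ (.famEq (.famApp A M) (.famApp B N) (K.inst M))
  | eq_pi_t {Γ : Ctx} {A₁ A₂ B₁ B₂ : Ty} (L : Finset Var)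
      (h₁ : Derives S Γ (.famEq A₁ B₁ .type))
      (hA : Derives S Γ (.fam A₁ .type))
      (h₂ : ∀ x ∉ L, Derives S (.var x A₁ :: Γ)
        (.famEq (A₂.inst (.fvar x)) (B₂.inst (.fvar x)) .type)) :
      Derives S Γ (.famEq (.pi A₁ A₂) (.pi B₁ B₂) .type)
  | eq_nm_t {Γ : Ctx} {α : NameType} (hα : SigDecl.name α ∈ S) :
      Derives S Γ (.famEq (.nameType α) (.nameType α) .type)
  | eq_new_t {Γ : Ctx} {α : NameType} {A B : Ty} (L : Finset Name)
      (hα : SigDecl.name α ∈ S)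
      (h : ∀ a ∉ L, Derives S (.name a α :: Γ)
        (.famEq (A.instName a) (B.instName a) .type)) :
      Derives S Γ (.famEq (.new α A) (.new α B) .type)
  | eq_ext_t {Γ : Ctx} {A₁ A₂ B : Ty} {K : Kd} (L : Finset Var)
      (hB : Derives S Γ (.fam B .type))
      (h : ∀ x ∉ L, Derives S (.var x B :: Γ)
        (.famEq (.famApp A₁ (.fvar x)) (.famApp A₂ (.fvar x)) (K.inst (.fvar x)))) :
      Derives S Γ (.famEq A₁ A₂ (.piK B K))
  | eq_symm_t {Γ : Ctx} {A B : Ty} {K : Kd} (h : Derives S Γ (.famEq A B K)) :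
      Derives S Γ (.famEq B A K)
  | eq_trans_t {Γ : Ctx} {A B C : Ty} {K : Kd}
      (h₁ : Derives S Γ (.famEq A B K)) (h₂ : Derives S Γ (.famEq B C K)) :
      Derives S Γ (.famEq A C K)
  | eq_conv_t {Γ : Ctx} {A B : Ty} {K K' : Kd}
      (h : Derives S Γ (.famEq A B K)) (hK : Derives S Γ (.kindEq K K')) :
      Derives S Γ (.famEq A B K')
  -- equality of objects
  | eq_con {Γ : Ctx} {c : ObjConst} {A : Ty} (hc : SigDecl.obj c A ∈ S) :
      Derives S Γ (.objEq (.objConst c) (.objConst c) A)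
  | eq_var {Γ : Ctx} {x : Var} {A : Ty} (hx : Entry.var x A ∈ Γ) :
      Derives S Γ (.objEq (.fvar x) (.fvar x) A)
  | eq_nm {Γ : Ctx} {a : Name} {α : NameType} (ha : Entry.name a α ∈ Γ) :
      Derives S Γ (.objEq (.name (.free a)) (.name (.free a)) (.nameType α))
  | eq_lam {Γ : Ctx} {A A' A'' B : Ty} {M N : Tm} (L : Finset Var)
      (hA' : Derives S Γ (.famEq A' A .type))
      (hA'' : Derives S Γ (.famEq A'' A .type))
      (hA : Derives S Γ (.fam A .type))
      (h : ∀ x ∉ L, Derives S (.var x A :: Γ)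
        (.objEq (M.inst (.fvar x)) (N.inst (.fvar x)) (B.inst (.fvar x)))) :
      Derives S Γ (.objEq (.lam A' M) (.lam A'' N) (.pi A B))
  | eq_app {Γ : Ctx} {A B : Ty} {M₁ M₂ N₁ N₂ : Tm}
      (h₁ : Derives S Γ (.objEq M₁ N₁ (.pi A B)))
      (h₂ : Derives S Γ (.objEq M₂ N₂ A)) :
      Derives S Γ (.objEq (.app M₁ M₂) (.app N₁ N₂) (B.inst M₂))
  | eq_abs {Γ : Ctx} {α : NameType} {A : Ty} {M N : Tm} (L : Finset Name)
      (hα : SigDecl.name α ∈ S)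
      (h : ∀ a ∉ L, Derives S (.name a α :: Γ)
        (.objEq (M.instName a) (N.instName a) (A.instName a))) :
      Derives S Γ (.objEq (.abs α M) (.abs α N) (.new α A))
  | eq_conc {Γ Γ' : Ctx} {b : Name} {α : NameType} {A : Ty} {M N : Tm}
      (hr : Restrict Γ b α Γ')
      (h : Derives S Γ' (.objEq M N (.new α A))) :
      Derives S Γ (.objEq (.conc M (.free b)) (.conc N (.free b)) (A.instName b))
  | eq_beta {Γ : Ctx} {A B : Ty} {M₁ M₂ N₁ N₂ : Tm} (L : Finset Var)
      (hA : Derives S Γ (.fam A .type))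
      (h₂ : ∀ x ∉ L, Derives S (.var x A :: Γ)
        (.objEq (M₂.inst (.fvar x)) (N₂.inst (.fvar x)) (B.inst (.fvar x))))
      (h₁ : Derives S Γ (.objEq M₁ N₁ A)) :
      Derives S Γ (.objEq (.app (.lam A M₂) M₁) (N₂.inst N₁) (B.inst M₁))
  | eq_ext {Γ : Ctx} {A B : Ty} {M N : Tm} (L : Finset Var)
      (hA : Derives S Γ (.fam A .type))
      (hM : Derives S Γ (.obj M (.pi A B)))
      (hN : Derives S Γ (.obj N (.pi A B)))
      (h : ∀ x ∉ L, Derives S (.var x A :: Γ)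
        (.objEq (.app M (.fvar x)) (.app N (.fvar x)) (B.inst (.fvar x)))) :
      Derives S Γ (.objEq M N (.pi A B))
  | eq_nm_beta {Γ Γ' : Ctx} {b : Name} {α : NameType} {A : Ty} {M N : Tm} (L : Finset Name)
      (hr : Restrict Γ b α Γ')
      (h : ∀ a ∉ L, Derives S (.name a α :: Γ')
        (.objEq (M.instName a) (N.instName a) (A.instName a))) :
      Derives S Γ (.objEq (.conc (.abs α M) (.free b)) (N.instName b) (A.instName b))
  | eq_nm_eta {Γ : Ctx} {α : NameType} {A : Ty} {M N : Tm} (L : Finset Name)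
      (hα : SigDecl.name α ∈ S)
      (h : ∀ a ∉ L, Derives S (.name a α :: Γ)
        (.objEq (.conc M (.free a)) (.conc N (.free a)) (A.instName a))) :
      Derives S Γ (.objEq M N (.new α A))
  | eq_symm {Γ : Ctx} {M N : Tm} {A : Ty} (h : Derives S Γ (.objEq M N A)) :
      Derives S Γ (.objEq N M A)
  | eq_trans {Γ : Ctx} {M N P : Tm} {A : Ty}
      (h₁ : Derives S Γ (.objEq M N A)) (h₂ : Derives S Γ (.objEq N P A)) :
      Derives S Γ (.objEq M P A)
  | eq_conv {Γ : Ctx} {M N : Tm} {A B : Ty}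
      (h : Derives S Γ (.objEq M N A)) (hAB : Derives S Γ (.famEq A B .type)) :
      Derives S Γ (.objEq M N B)

/-- Well-formed signatures: constants are declared at most once, and classified by closed kinds
and types that are well-formed over the preceding declarations. -/
inductive SigWF : Sig → Prop
  | nil : SigWF []
  | fam {S : Sig} {a : FamConst} {K : Kd} (hS : SigWF S)
      (hfresh : ∀ K', SigDecl.fam a K' ∉ S) (hK : Derives S [] (.kind K)) :
      SigWF (.fam a K :: S)
  | obj {S : Sig} {c : ObjConst} {A : Ty} (hS : SigWF S)
      (hfresh : ∀ A', SigDecl.obj c A' ∉ S) (hA : Derives S [] (.fam A .type)) :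
      SigWF (.obj c A :: S)
  | name {S : Sig} {α : NameType} (hS : SigWF S) (hfresh : SigDecl.name α ∉ S) :
      SigWF (.name α :: S)

/-- Well-formed contexts over a signature; the variables and names declared are distinct. -/
inductive CtxWF (S : Sig) : Ctx → Prop
  | nil : CtxWF S []
  | var {Γ : Ctx} {x : Var} {A : Ty} (hΓ : CtxWF S Γ)
      (hfresh : ∀ A', Entry.var x A' ∉ Γ) (hA : Derives S Γ (.fam A .type)) :
      CtxWF S (.var x A :: Γ)
  | name {Γ : Ctx} {a : Name} {α : NameType} (hΓ : CtxWF S Γ)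
      (hfresh : ∀ α', Entry.name a α' ∉ Γ) (hα : SigDecl.name α ∈ S) :
      CtxWF S (.name a α :: Γ)

/-! ### Weak head reduction -/

/-- Weak head reduction of objects. -/
inductive WHR : Tm → Tm → Prop
  | app {M M' : Tm} (N : Tm) (h : WHR M M') : WHR (.app M N) (.app M' N)
  | beta (A : Ty) (M N : Tm) : WHR (.app (.lam A M) N) (M.inst N)
  | conc {M M' : Tm} (a : Name) (h : WHR M M') : WHR (.conc M (.free a)) (.conc M' (.free a))
  | nm_beta (α : NameType) (M : Tm) (b : Name) :
      WHR (.conc (.abs α M) (.free b)) (M.instName b)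

end NomLF

/-!
Subject reduction is proved by induction on weak head reduction. Congruence steps follow by
inverting the typing derivation and applying the matching congruence rule. For a `β`-step from
`(λx:A.M) N`, inversion gives `Γ, x:A ⊢ M : B`, an argument `N : A₁` and an equality
`Πx:A.B = Πx:A₁.B₁`. Injectivity of `Π` turns `N : A₁` into `N : A` and `B` into `B₁`, so that the
`β`-rule applied to the reflexivity instances of `M` and `N`, and substitution in `M`, give both
conclusions. A step from `(⟨a:α⟩M)@b` is treated alike, with injectivity of `и`.

Two results carry the argument.

* Injectivity of `Π` and `и` (`Derives.headEqIn`). As there is no abstraction at the level of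
  families, equality derivations at the kind `type` preserve the outermost former: transitivity
  cannot pass from a `Π`-type through anything but `Π`-types, and family extensionality never
  concludes at the kind `type`. Hence a plain induction on derivations suffices, and neither
  normalization nor regularity of the equality judgments is needed.
* The substitution theorem (`Derives.subst`), for simultaneous substitutions of objects for
  variables combined with renamings of names. The premises of the concretion rules live in a
  restricted context, so a substitution must survive restriction of its source and target. It is
  therefore given together with a relation between contexts that is closed under corresponding
  restrictions and under fresh extensions. Weakening, context conversion, substitution for a
  variable, and the passage from `Γ' # a:α` to `Γ` with `b` for `a`, where `Γ - b:α = Γ'`, are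
  instances. The last one rests on restrictions by distinct names commuting (`Restrict.swap`).
-/

namespace NomLF

namespace Exp

/-! ### Free atoms, local closure and substitution -/

/-- The free variables of an expression. -/
def fv : {c : Cls} → Exp c → Finset Var
  | _, .type => ∅
  | _, .piK A K => fv A ∪ fv K
  | _, .famConst _ => ∅
  | _, .famApp A M => fv A ∪ fv M
  | _, .pi A B => fv A ∪ fv B
  | _, .nameType _ => ∅
  | _, .new _ B => fv B
  | _, .objConst _ => ∅
  | _, .bvar _ => ∅
  | _, .fvar x => {x}
  | _, .lam A M => fv A ∪ fv M
  | _, .app M N => fv M ∪ fv N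
  | _, .name _ => ∅
  | _, .abs _ M => fv M
  | _, .conc M _ => fv M

end Exp

/-- The free names of a name occurrence. -/
def NameRef.fn : NameRef → Finset Name
  | .bound _ => ∅
  | .free a => {a}

/-- Renaming of the free name in a name occurrence. -/
def NameRef.rename (ρ : Name → Name) : NameRef → NameRef
  | .bound i => .bound i
  | .free a => .free (ρ a)

/-- The occurrence is free or has an index below `m`. -/
def NameRef.LC (m : ℕ) : NameRef → Prop
  | .bound i => i < m
  | .free _ => True

namespace Exp

/-- The free names of an expression. -/
def fn : {c : Cls} → Exp c → Finset Name
  | _, .type => ∅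
  | _, .piK A K => fn A ∪ fn K
  | _, .famConst _ => ∅
  | _, .famApp A M => fn A ∪ fn M
  | _, .pi A B => fn A ∪ fn B
  | _, .nameType _ => ∅
  | _, .new _ B => fn B
  | _, .objConst _ => ∅
  | _, .bvar _ => ∅
  | _, .fvar _ => ∅
  | _, .lam A M => fn A ∪ fn M
  | _, .app M N => fn M ∪ fn N
  | _, .name a => a.fn
  | _, .abs _ M => fn M
  | _, .conc M a => fn M ∪ a.fn

/-- `LC n m e`: every dangling variable index of `e` is below `n` and every dangling name index is
below `m`. Local closure is `LC 0 0`. -/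
def LC : {c : Cls} → ℕ → ℕ → Exp c → Prop
  | _, _, _, .type => True
  | _, n, m, .piK A K => LC n m A ∧ LC (n + 1) m K
  | _, _, _, .famConst _ => True
  | _, n, m, .famApp A M => LC n m A ∧ LC n m M
  | _, n, m, .pi A B => LC n m A ∧ LC (n + 1) m B
  | _, _, _, .nameType _ => True
  | _, n, m, .new _ B => LC n (m + 1) B
  | _, _, _, .objConst _ => True
  | _, n, _, .bvar i => i < n
  | _, _, _, .fvar _ => True
  | _, n, m, .lam A M => LC n m A ∧ LC (n + 1) m M
  | _, n, m, .app M N => LC n m M ∧ LC n m N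
  | _, _, m, .name a => a.LC m
  | _, n, m, .abs _ M => LC n (m + 1) M
  | _, n, m, .conc M a => LC n m M ∧ a.LC m

/-- Simultaneous substitution of the objects `σ x` for the free variables `x` and renaming of the
free names `a` to `ρ a`. The objects `σ x` are meant to be locally closed, so that no capture can
occur. -/
def subst (σ : Var → Tm) (ρ : Name → Name) : {c : Cls} → Exp c → Exp c
  | _, .type => .type
  | _, .piK A K => .piK (subst σ ρ A) (subst σ ρ K)
  | _, .famConst a => .famConst a
  | _, .famApp A M => .famApp (subst σ ρ A) (subst σ ρ M)
  | _, .pi A B => .pi (subst σ ρ A) (subst σ ρ B)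
  | _, .nameType α => .nameType α
  | _, .new α B => .new α (subst σ ρ B)
  | _, .objConst c => .objConst c
  | _, .bvar i => .bvar i
  | _, .fvar x => σ x
  | _, .lam A M => .lam (subst σ ρ A) (subst σ ρ M)
  | _, .app M N => .app (subst σ ρ M) (subst σ ρ N)
  | _, .name a => .name (a.rename ρ)
  | _, .abs α M => .abs α (subst σ ρ M)
  | _, .conc M a => .conc (subst σ ρ M) (a.rename ρ)

variable {c : Cls}

theorem openVarAt_eq_self {u : Tm} {e : Exp c} {n m k : ℕ} (h : LC n m e) (hk : n ≤ k) :
    openVarAt u k e = e := by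
  induction e generalizing n m k with
  | piK _ _ ih₁ ih₂ | pi _ _ ih₁ ih₂ | lam _ _ ih₁ ih₂ =>
    exact congrArg₂ _ (ih₁ h.1 hk) (ih₂ h.2 (Nat.succ_le_succ hk))
  | _ => simp only [LC, openVarAt] at *; try grind

theorem _root_.NomLF.NameRef.openAt_eq_self {b : Name} {r : NameRef} {m k : ℕ} (h : r.LC m)
    (hk : m ≤ k) : r.openAt b k = r := by
  cases r <;> grind [NameRef.LC, NameRef.openAt]

theorem openNameAt_eq_self {b : Name} {e : Exp c} {n m k : ℕ} (h : LC n m e) (hk : m ≤ k) :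
    openNameAt b k e = e := by
  induction e generalizing n m k with
  | new _ _ ih | abs _ _ ih => exact congrArg _ (ih h (Nat.succ_le_succ hk))
  | _ => simp only [LC, openNameAt] at *; try grind [NameRef.openAt_eq_self]

theorem LC.of_openVarAt {x : Var} {e : Exp c} {n m : ℕ}
    (h : LC n m (openVarAt (.fvar x) n e)) : LC (n + 1) m e := by
  induction e generalizing n m <;> simp only [LC, openVarAt] at * <;> grind [LC]

theorem _root_.NomLF.NameRef.LC.of_openAt {b : Name} {r : NameRef} {m : ℕ}
    (h : (r.openAt b m).LC m) : r.LC (m + 1) := by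
  cases r <;> grind [NameRef.LC, NameRef.openAt]

theorem LC.of_openNameAt {b : Name} {e : Exp c} {n m : ℕ}
    (h : LC n m (openNameAt b m e)) : LC n (m + 1) e := by
  induction e generalizing n m <;> simp only [LC, openNameAt] at * <;>
    grind [NameRef.LC.of_openAt]

theorem fv_subset_openVarAt (u : Tm) (e : Exp c) (k : ℕ) : e.fv ⊆ (openVarAt u k e).fv := by
  induction e generalizing k <;> simp only [fv, openVarAt] at * <;> grind

theorem fn_subset_openVarAt (u : Tm) (e : Exp c) (k : ℕ) : e.fn ⊆ (openVarAt u k e).fn := by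
  induction e generalizing k <;> simp only [fn, openVarAt] at * <;> grind

theorem fv_subset_openNameAt (b : Name) (e : Exp c) (k : ℕ) : e.fv ⊆ (openNameAt b k e).fv := by
  induction e generalizing k <;> simp only [fv, openNameAt] at * <;> grind

theorem _root_.NomLF.NameRef.fn_subset_openAt (b : Name) (r : NameRef) (k : ℕ) :
    r.fn ⊆ (r.openAt b k).fn := by
  cases r <;> simp [NameRef.fn, NameRef.openAt]

theorem fn_subset_openNameAt (b : Name) (e : Exp c) (k : ℕ) : e.fn ⊆ (openNameAt b k e).fn := by
  induction e generalizing k <;> simp only [fn, openNameAt] at * <;>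
    grind [NameRef.fn_subset_openAt]

theorem _root_.NomLF.NameRef.rename_eq_self {ρ : Name → Name} {r : NameRef}
    (h : ∀ a ∈ r.fn, ρ a = a) : r.rename ρ = r := by
  cases r <;> simp_all [NameRef.fn, NameRef.rename]

theorem subst_eq_self {σ : Var → Tm} {ρ : Name → Name} {e : Exp c}
    (hσ : ∀ x ∈ e.fv, σ x = .fvar x) (hρ : ∀ a ∈ e.fn, ρ a = a) : e.subst σ ρ = e := by
  induction e <;> simp only [fv, fn, subst] at * <;> grind [NameRef.rename_eq_self]

@[simp]
theorem subst_id (e : Exp c) : e.subst .fvar id = e :=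
  subst_eq_self (fun _ _ => rfl) fun _ _ => rfl

theorem subst_openVarAt {σ : Var → Tm} (ρ : Name → Name) (hσ : ∀ x, (σ x).LC 0 0) (u : Tm)
    (e : Exp c) (k : ℕ) :
    (openVarAt u k e).subst σ ρ = openVarAt (u.subst σ ρ) k (e.subst σ ρ) := by
  induction e generalizing k <;> simp only [subst, openVarAt] at * <;>
    grind [subst, openVarAt_eq_self]

theorem _root_.NomLF.NameRef.rename_openAt (ρ : Name → Name) (b : Name) (r : NameRef) (k : ℕ) :
    (r.openAt b k).rename ρ = (r.rename ρ).openAt (ρ b) k := by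
  cases r <;> grind [NameRef.rename, NameRef.openAt]

theorem subst_openNameAt {σ : Var → Tm} (ρ : Name → Name) (hσ : ∀ x, (σ x).LC 0 0) (b : Name)
    (e : Exp c) (k : ℕ) :
    (openNameAt b k e).subst σ ρ = openNameAt (ρ b) k (e.subst σ ρ) := by
  induction e generalizing k <;> simp only [subst, openNameAt] at * <;>
    grind [openNameAt_eq_self, NameRef.rename_openAt]

end Exp

/-! ### Restriction and freshness for contexts -/

theorem Restrict.sublist {Γ Γ' : Ctx} {a : Name} {α : NameType} (h : Restrict Γ a α Γ') :
    List.Sublist Γ' Γ := by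
  induction h with
  | id => exact List.sublist_cons_self _ _
  | nm _ _ _ _ ih => exact ih.cons_cons _
  | var _ _ _ ih => exact ih.cons _

theorem Restrict.subset {Γ Γ' : Ctx} {a : Name} {α : NameType} (h : Restrict Γ a α Γ') :
    Γ' ⊆ Γ :=
  h.sublist.subset

theorem Restrict.mem {Γ Γ' : Ctx} {a : Name} {α : NameType} (h : Restrict Γ a α Γ') :
    Entry.name a α ∈ Γ := by
  induction h with
  | id => simp
  | nm _ _ _ _ ih => exact List.mem_cons_of_mem _ ih
  | var _ _ _ ih => exact List.mem_cons_of_mem _ ih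

/-- Restrictions by distinct names commute. -/
theorem Restrict.swap {Γ Γ' Γ'' : Ctx} {b c : Name} {β γ : NameType} (hb : Restrict Γ b β Γ')
    (hc : Restrict Γ' c γ Γ'') (hbc : b ≠ c) :
    ∃ Δ, Restrict Γ c γ Δ ∧ Restrict Δ b β Γ'' := by
  induction hb generalizing Γ'' with
  | id Γ b β => exact ⟨_, .nm _ _ hbc hc, .id _ _ _⟩
  | @nm Γ Γ' b β a α hab h ih =>
    cases hc with
    | id => exact ⟨_, .id _ _ _, h⟩
    | nm _ _ hac hc =>
      obtain ⟨Δ, h₁, h₂⟩ := ih hc hbc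
      exact ⟨_, .nm _ _ hac h₁, .nm _ _ hab h₂⟩
  | var x A _ ih =>
    obtain ⟨Δ, h₁, h₂⟩ := ih hc hbc
    exact ⟨_, .var _ _ h₁, h₂⟩

/-- The name declared by a context entry, if any. -/
def Entry.name? : Entry → Option Name
  | .var _ _ => none
  | .name a _ => some a

/-- The names declared in `Γ` are distinct. Unlike well-formedness, this is plainly inherited by
restrictions. -/
def DistinctNames (Γ : Ctx) : Prop :=
  (Γ.filterMap Entry.name?).Nodup

theorem mem_names_iff {Γ : Ctx} {a : Name} :
    a ∈ Γ.filterMap Entry.name? ↔ ∃ α, Entry.name a α ∈ Γ := by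
  simp only [List.mem_filterMap]
  constructor
  · rintro ⟨_ | ⟨b, β⟩, h, h'⟩ <;> cases h'
    exact ⟨_, h⟩
  · rintro ⟨α, h⟩
    exact ⟨_, h, rfl⟩

theorem CtxWF.distinctNames {S : Sig} {Γ : Ctx} (hΓ : CtxWF S Γ) : DistinctNames Γ := by
  induction hΓ with
  | nil => exact List.nodup_nil
  | var _ _ _ ih => exact ih
  | name _ hfresh _ ih =>
    exact List.nodup_cons.2 ⟨fun h => (mem_names_iff.1 h).elim hfresh, ih⟩

theorem DistinctNames.restrict {Γ Γ' : Ctx} {b : Name} {β : NameType} (hΓ : DistinctNames Γ)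
    (h : Restrict Γ b β Γ') : DistinctNames Γ' :=
  hΓ.sublist (h.sublist.filterMap _)

theorem DistinctNames.notMem_restrict {Γ Γ' : Ctx} {b : Name} {β : NameType}
    (hΓ : DistinctNames Γ) (h : Restrict Γ b β Γ') (β' : NameType) : Entry.name b β' ∉ Γ' := by
  induction h with
  | id => exact fun hb => (List.nodup_cons.1 hΓ).1 (mem_names_iff.2 ⟨β', hb⟩)
  | nm c γ hcb _ ih =>
    have := ih (List.nodup_cons.1 hΓ).2
    grind
  | var _ _ _ ih => exact ih hΓ

theorem exists_fresh_var (Γ : Ctx) :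
    ∃ L : Finset Var, ∀ x ∉ L, ∀ y B, Entry.var y B ∈ Γ → y ≠ x ∧ x ∉ B.fv := by
  induction Γ with
  | nil => simp
  | cons E Γ ih =>
    obtain ⟨L, hL⟩ := ih
    cases E with
    | var y B => exact ⟨insert y (L ∪ B.fv), by grind⟩
    | name => exact ⟨L, by grind⟩

theorem exists_fresh_name (Γ : Ctx) :
    ∃ L : Finset Name, ∀ a ∉ L, (∀ b β, Entry.name b β ∈ Γ → b ≠ a) ∧
      ∀ y B, Entry.var y B ∈ Γ → a ∉ B.fn := by
  induction Γ with
  | nil => simp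
  | cons E Γ ih =>
    obtain ⟨L, hL⟩ := ih
    cases E with
    | var y B => exact ⟨L ∪ B.fn, by grind⟩
    | name b β => exact ⟨insert b L, by grind⟩

/-! ### Scoping of typable expressions -/

/-- `e` is locally closed and all its free atoms are declared in `Γ`. -/
structure Exp.ScopedIn {c : Cls} (Γ : Ctx) (e : Exp c) : Prop where
  lc : e.LC 0 0
  fv : ∀ x ∈ e.fv, ∃ A, Entry.var x A ∈ Γ
  fn : ∀ a ∈ e.fn, ∃ α, Entry.name a α ∈ Γ

/-- The subject of a typing judgment is scoped in `Γ`; equality judgments are unconstrained. -/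
def Judgment.ScopedIn (Γ : Ctx) : Judgment → Prop
  | .kind K => K.ScopedIn Γ
  | .fam A _ => A.ScopedIn Γ
  | .obj M _ => M.ScopedIn Γ
  | .kindEq _ _ | .famEq _ _ _ | .objEq _ _ _ => True

namespace Exp

variable {c : Cls}

theorem ScopedIn.of_inst {Γ : Ctx} {A : Ty} {e : Exp c} {L : Finset Var}
    (h : ∀ x ∉ L, (e.inst (.fvar x)).ScopedIn (.var x A :: Γ)) :
    e.LC 1 0 ∧ (∀ x ∈ e.fv, ∃ A, Entry.var x A ∈ Γ) ∧ ∀ a ∈ e.fn, ∃ α, Entry.name a α ∈ Γ := by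
  obtain ⟨x, hx⟩ := Infinite.exists_notMem_finset (L ∪ e.fv)
  simp only [Finset.mem_union, not_or] at hx
  have hs := h x hx.1
  refine ⟨.of_openVarAt hs.lc, fun y hy => ?_, fun a ha => ?_⟩
  · obtain ⟨B, hB⟩ := hs.fv y (fv_subset_openVarAt _ _ _ hy)
    grind
  · obtain ⟨B, hB⟩ := hs.fn a (fn_subset_openVarAt _ _ _ ha)
    grind

theorem ScopedIn.of_instName {Γ : Ctx} {α : NameType} {e : Exp c} {L : Finset Name}
    (h : ∀ a ∉ L, (e.instName a).ScopedIn (.name a α :: Γ)) :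
    e.LC 0 1 ∧ (∀ x ∈ e.fv, ∃ A, Entry.var x A ∈ Γ) ∧ ∀ a ∈ e.fn, ∃ α, Entry.name a α ∈ Γ := by
  obtain ⟨x, hx⟩ := Infinite.exists_notMem_finset (L ∪ e.fn)
  simp only [Finset.mem_union, not_or] at hx
  have hs := h x hx.1
  refine ⟨.of_openNameAt hs.lc, fun y hy => ?_, fun a ha => ?_⟩
  · obtain ⟨B, hB⟩ := hs.fv y (fv_subset_openNameAt _ _ _ hy)
    grind
  · obtain ⟨B, hB⟩ := hs.fn a (fn_subset_openNameAt _ _ _ ha)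
    grind

theorem ScopedIn.mono {Γ Δ : Ctx} {e : Exp c} (h : e.ScopedIn Γ) (hΓ : Γ ⊆ Δ) :
    e.ScopedIn Δ :=
  ⟨h.lc, fun x hx => (h.fv x hx).imp fun _ h => hΓ h, fun a ha => (h.fn a ha).imp fun _ h => hΓ h⟩

end Exp

theorem Derives.scopedIn {S : Sig} {Γ : Ctx} {J : Judgment} (h : Derives S Γ J) :
    J.ScopedIn Γ := by
  induction h with
  | pi_k L _ _ ihA ih | pi_t L _ _ ihA ih | lam_o L _ _ ihA ih =>
    obtain ⟨h₁, h₂, h₃⟩ := Exp.ScopedIn.of_inst ih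
    obtain ⟨k₁, k₂, k₃⟩ := ihA
    constructor <;> simp only [Exp.LC, Exp.fv, Exp.fn] <;> grind
  | new_t L _ _ ih | abs_o L _ _ ih =>
    obtain ⟨h₁, h₂, h₃⟩ := Exp.ScopedIn.of_instName ih
    exact ⟨h₁, h₂, h₃⟩
  | app_t _ _ ih₁ ih₂ | app_o _ _ ih₁ ih₂ =>
    obtain ⟨h₁, h₂, h₃⟩ := ih₁
    obtain ⟨k₁, k₂, k₃⟩ := ih₂
    constructor <;> simp only [Exp.LC, Exp.fv, Exp.fn] <;> grind
  | conv_t _ _ ih | conv_o _ _ ih => exact ih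
  | conc_o hr _ ih =>
    have ih := Exp.ScopedIn.mono ih hr.subset
    have := hr.mem
    obtain ⟨h₁, h₂, h₃⟩ := ih
    constructor <;> simp only [Exp.LC, Exp.fv, Exp.fn, NameRef.fn, NameRef.LC] <;> grind
  | type_k | con_t | nm_t | con_o | var_o | nm_o =>
    constructor <;> simp only [Exp.LC, Exp.fv, Exp.fn, NameRef.fn, NameRef.LC] <;> grind
  | _ => trivial

theorem SigWF.subst_kind {S : Sig} (hS : SigWF S) {a : FamConst} {K : Kd}
    (h : SigDecl.fam a K ∈ S) (σ : Var → Tm) (ρ : Name → Name) : K.subst σ ρ = K := by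
  induction hS with
  | nil => simp at h
  | fam _ _ hK ih =>
    rcases List.mem_cons.1 h with h | h
    · cases h
      have := hK.scopedIn
      exact Exp.subst_eq_self (fun x hx => by simpa using this.fv x hx)
        (fun x hx => by simpa using this.fn x hx)
    · exact ih h
  | obj _ _ _ ih => exact ih (by simpa using h)
  | name _ _ ih => exact ih (by simpa using h)

theorem SigWF.subst_type {S : Sig} (hS : SigWF S) {c : ObjConst} {A : Ty}
    (h : SigDecl.obj c A ∈ S) (σ : Var → Tm) (ρ : Name → Name) : A.subst σ ρ = A := by
  induction hS with
  | nil => simp at h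
  | obj _ _ hA ih =>
    rcases List.mem_cons.1 h with h | h
    · cases h
      have := hA.scopedIn
      exact Exp.subst_eq_self (fun x hx => by simpa using this.fv x hx)
        (fun x hx => by simpa using this.fn x hx)
    · exact ih h
  | fam _ _ _ ih => exact ih (by simpa using h)
  | name _ _ ih => exact ih (by simpa using h)

/-! ### Reflexivity of definitional equality -/

/-- The reflexivity instance of definitional equality that belongs to a typing judgment. -/
def Judgment.ReflIn (S : Sig) (Γ : Ctx) : Judgment → Prop
  | .fam A K => Derives S Γ (.famEq A A K)
  | .obj M A => Derives S Γ (.objEq M M A)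
  | .kind _ | .kindEq _ _ | .famEq _ _ _ | .objEq _ _ _ => True

theorem Derives.reflIn {S : Sig} {Γ : Ctx} {J : Judgment} (h : Derives S Γ J) :
    J.ReflIn S Γ := by
  induction h with
  | con_t ha => exact .eq_con_t ha
  | app_t _ _ ih₁ ih₂ => exact .eq_app_t ih₁ ih₂
  | pi_t L hA _ ih₁ ih₂ => exact .eq_pi_t L ih₁ hA ih₂
  | conv_t _ hK ih => exact .eq_conv_t ih (.eq_symm_k hK)
  | nm_t hα => exact .eq_nm_t hα
  | new_t L hα _ ih => exact .eq_new_t L hα ih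
  | con_o hc => exact .eq_con hc
  | var_o hx => exact .eq_var hx
  | nm_o ha => exact .eq_nm ha
  | lam_o L hA _ ih₁ ih₂ => exact .eq_lam L ih₁ ih₁ hA ih₂
  | app_o _ _ ih₁ ih₂ => exact .eq_app ih₁ ih₂
  | abs_o L hα _ ih => exact .eq_abs L hα ih
  | conc_o hr _ ih => exact .eq_conc hr ih
  | conv_o _ hAB ih => exact .eq_conv ih hAB
  | _ => trivial

theorem Derives.refl {S : Sig} {Γ : Ctx} {M : Tm} {A : Ty} (h : Derives S Γ (.obj M A)) :
    Derives S Γ (.objEq M M A) :=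
  h.reflIn

/-! ### The substitution theorem -/

/-- Substitution in every part of a judgment. -/
def Judgment.subst (σ : Var → Tm) (ρ : Name → Name) : Judgment → Judgment
  | .kind K => .kind (K.subst σ ρ)
  | .fam A K => .fam (A.subst σ ρ) (K.subst σ ρ)
  | .obj M A => .obj (M.subst σ ρ) (A.subst σ ρ)
  | .kindEq K K' => .kindEq (K.subst σ ρ) (K'.subst σ ρ)
  | .famEq A A' K => .famEq (A.subst σ ρ) (A'.subst σ ρ) (K.subst σ ρ)
  | .objEq M M' A => .objEq (M.subst σ ρ) (M'.subst σ ρ) (A.subst σ ρ)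

/-- `R Γ Δ` implies that `(σ, ρ)` is a well-typed substitution from `Γ` to `Δ`, and `R` is
preserved when both contexts are restricted by corresponding names. The last requirement is what
the concretion rules need, since their main premise lives in a restricted context. -/
structure IsSubst (S : Sig) (σ : Var → Tm) (ρ : Name → Name) (R : Ctx → Ctx → Prop) : Prop where
  lc : ∀ x, (σ x).LC 0 0
  var : ∀ {Γ Δ x A}, R Γ Δ → Entry.var x A ∈ Γ → Derives S Δ (.obj (σ x) (A.subst σ ρ))
  name : ∀ {Γ Δ a α}, R Γ Δ → Entry.name a α ∈ Γ → Entry.name (ρ a) α ∈ Δ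
  restrict : ∀ {Γ Δ Γ' b β}, R Γ Δ → Restrict Γ b β Γ' →
    ∃ Δ', Restrict Δ (ρ b) β Δ' ∧ R Γ' Δ'

/-- An `IsSubst` relation that is moreover preserved under extension of both contexts by almost
any variable or name. -/
structure IsLiftableSubst (S : Sig) (σ : Var → Tm) (ρ : Name → Name) (R : Ctx → Ctx → Prop) : Prop
    extends IsSubst S σ ρ R where
  consVar : ∀ {Γ Δ}, R Γ Δ → ∃ L : Finset Var, ∀ x ∉ L, σ x = .fvar x ∧
    ∀ A, R (.var x A :: Γ) (.var x (A.subst σ ρ) :: Δ)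
  consName : ∀ {Γ Δ}, R Γ Δ → ∃ L : Finset Name, ∀ a ∉ L, ρ a = a ∧
    ∀ α, R (.name a α :: Γ) (.name a α :: Δ)

section

variable {S : Sig} {σ : Var → Tm} {ρ : Name → Name} {R : Ctx → Ctx → Prop}

theorem IsSubst.inst {c : Cls} (h : IsSubst S σ ρ R) (e : Exp c) (N : Tm) :
    (e.inst N).subst σ ρ = (e.subst σ ρ).inst (N.subst σ ρ) :=
  Exp.subst_openVarAt ρ h.lc N e 0

theorem IsSubst.instName {c : Cls} (h : IsSubst S σ ρ R) (e : Exp c) (b : Name) :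
    (e.instName b).subst σ ρ = (e.subst σ ρ).instName (ρ b) :=
  Exp.subst_openNameAt ρ h.lc b e 0

theorem IsLiftableSubst.under_var (h : IsLiftableSubst S σ ρ R) {Γ Δ : Ctx} (hR : R Γ Δ) {A : Ty}
    {L : Finset Var} {J : Var → Judgment}
    (hJ : ∀ x ∉ L, ∀ Δ, R (.var x A :: Γ) Δ → Derives S Δ ((J x).subst σ ρ)) :
    ∃ L' : Finset Var, ∀ x ∉ L', σ x = .fvar x ∧
      Derives S (.var x (A.subst σ ρ) :: Δ) ((J x).subst σ ρ) := by
  obtain ⟨L', hL'⟩ := h.consVar hR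
  exact ⟨L ∪ L', fun x hx => by
    simp only [Finset.mem_union, not_or] at hx
    exact ⟨(hL' x hx.2).1, hJ x hx.1 _ ((hL' x hx.2).2 A)⟩⟩

theorem IsLiftableSubst.under_name (h : IsLiftableSubst S σ ρ R) {Γ Δ : Ctx} (hR : R Γ Δ)
    {α : NameType} {L : Finset Name} {J : Name → Judgment}
    (hJ : ∀ a ∉ L, ∀ Δ, R (.name a α :: Γ) Δ → Derives S Δ ((J a).subst σ ρ)) :
    ∃ L' : Finset Name, ∀ a ∉ L', ρ a = a ∧
      Derives S (.name a α :: Δ) ((J a).subst σ ρ) := by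
  obtain ⟨L', hL'⟩ := h.consName hR
  exact ⟨L ∪ L', fun x hx => by
    simp only [Finset.mem_union, not_or] at hx
    exact ⟨(hL' x hx.2).1, hJ x hx.1 _ ((hL' x hx.2).2 α)⟩⟩

/-- The substitution theorem, for every judgment form at once. -/
theorem Derives.subst (hS : SigWF S) (h : IsLiftableSubst S σ ρ R) {Γ Δ : Ctx} {J : Judgment}
    (hJ : Derives S Γ J) (hR : R Γ Δ) : Derives S Δ (J.subst σ ρ) := by
  have i := @h.inst
  have n := @h.instName
  induction hJ generalizing Δ with
  | type_k => exact .type_k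
  | pi_k _ _ _ ihA ih =>
    obtain ⟨L', hL⟩ := h.under_var hR @ih
    refine .pi_k L' (ihA hR) ?_
    intro x hx
    obtain ⟨hx, hJ⟩ := hL x hx
    simpa [Judgment.subst, Exp.subst, i, hx] using hJ
  | con_t ha =>
    simp only [Judgment.subst, hS.subst_kind ha]
    exact .con_t ha
  | app_t _ _ ih₁ ih₂ =>
    simp only [Judgment.subst, i]
    exact .app_t (ih₁ hR) (ih₂ hR)
  | pi_t _ _ _ ihA ih =>
    obtain ⟨L', hL⟩ := h.under_var hR @ih
    refine .pi_t L' (ihA hR) ?_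
    intro x hx
    obtain ⟨hx, hJ⟩ := hL x hx
    simpa [Judgment.subst, Exp.subst, i, hx] using hJ
  | conv_t _ _ ih₁ ih₂ => exact .conv_t (ih₁ hR) (ih₂ hR)
  | nm_t hα => exact .nm_t hα
  | new_t _ hα _ ih =>
    obtain ⟨L', hL⟩ := h.under_name hR @ih
    refine .new_t L' hα ?_
    intro a ha
    obtain ⟨ha, hJ⟩ := hL a ha
    simpa [Judgment.subst, Exp.subst, n, ha] using hJ
  | con_o hc =>
    simp only [Judgment.subst, hS.subst_type hc]
    exact .con_o hc
  | var_o hx => exact h.var hR hx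
  | nm_o ha => exact .nm_o (h.name hR ha)
  | lam_o _ _ _ ihA ih =>
    obtain ⟨L', hL⟩ := h.under_var hR @ih
    refine .lam_o L' (ihA hR) ?_
    intro x hx
    obtain ⟨hx, hJ⟩ := hL x hx
    simpa [Judgment.subst, Exp.subst, i, hx] using hJ
  | app_o _ _ ih₁ ih₂ =>
    simp only [Judgment.subst, i]
    exact .app_o (ih₁ hR) (ih₂ hR)
  | abs_o _ hα _ ih =>
    obtain ⟨L', hL⟩ := h.under_name hR @ih
    refine .abs_o L' hα ?_
    intro a ha
    obtain ⟨ha, hJ⟩ := hL a ha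
    simpa [Judgment.subst, Exp.subst, n, ha] using hJ
  | conc_o hr _ ih =>
    obtain ⟨Δ', hr', hR'⟩ := h.restrict hR hr
    simp only [Judgment.subst, n]
    exact .conc_o hr' (ih hR')
  | conv_o _ _ ih₁ ih₂ => exact .conv_o (ih₁ hR) (ih₂ hR)
  | eq_type_k => exact .eq_type_k
  | eq_pi_k _ _ _ _ ihAB ihA ih =>
    obtain ⟨L', hL⟩ := h.under_var hR @ih
    refine .eq_pi_k L' (ihAB hR) (ihA hR) ?_
    intro x hx
    obtain ⟨hx, hJ⟩ := hL x hx
    simpa [Judgment.subst, Exp.subst, i, hx] using hJ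
  | eq_symm_k _ ih => exact .eq_symm_k (ih hR)
  | eq_trans_k _ _ ih₁ ih₂ => exact .eq_trans_k (ih₁ hR) (ih₂ hR)
  | eq_con_t ha =>
    simp only [Judgment.subst, hS.subst_kind ha]
    exact .eq_con_t ha
  | eq_app_t _ _ ih₁ ih₂ =>
    simp only [Judgment.subst, i]
    exact .eq_app_t (ih₁ hR) (ih₂ hR)
  | eq_pi_t _ _ _ _ ihAB ihA ih =>
    obtain ⟨L', hL⟩ := h.under_var hR @ih
    refine .eq_pi_t L' (ihAB hR) (ihA hR) ?_
    intro x hx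
    obtain ⟨hx, hJ⟩ := hL x hx
    simpa [Judgment.subst, Exp.subst, i, hx] using hJ
  | eq_nm_t hα => exact .eq_nm_t hα
  | eq_new_t _ hα _ ih =>
    obtain ⟨L', hL⟩ := h.under_name hR @ih
    refine .eq_new_t L' hα ?_
    intro a ha
    obtain ⟨ha, hJ⟩ := hL a ha
    simpa [Judgment.subst, Exp.subst, n, ha] using hJ
  | eq_ext_t _ _ _ ihB ih =>
    obtain ⟨L', hL⟩ := h.under_var hR @ih
    refine .eq_ext_t L' (ihB hR) ?_
    intro x hx
    obtain ⟨hx, hJ⟩ := hL x hx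
    simpa [Judgment.subst, Exp.subst, i, hx] using hJ
  | eq_symm_t _ ih => exact .eq_symm_t (ih hR)
  | eq_trans_t _ _ ih₁ ih₂ => exact .eq_trans_t (ih₁ hR) (ih₂ hR)
  | eq_conv_t _ _ ih₁ ih₂ => exact .eq_conv_t (ih₁ hR) (ih₂ hR)
  | eq_con hc =>
    simp only [Judgment.subst, hS.subst_type hc]
    exact .eq_con hc
  | eq_var hx => exact (h.var hR hx).refl
  | eq_nm ha => exact .eq_nm (h.name hR ha)
  | eq_lam _ _ _ _ _ ih₁ ih₂ ihA ih =>
    obtain ⟨L', hL⟩ := h.under_var hR @ih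
    refine .eq_lam L' (ih₁ hR) (ih₂ hR) (ihA hR) ?_
    intro x hx
    obtain ⟨hx, hJ⟩ := hL x hx
    simpa [Judgment.subst, Exp.subst, i, hx] using hJ
  | eq_app _ _ ih₁ ih₂ =>
    simp only [Judgment.subst, i]
    exact .eq_app (ih₁ hR) (ih₂ hR)
  | eq_abs _ hα _ ih =>
    obtain ⟨L', hL⟩ := h.under_name hR @ih
    refine .eq_abs L' hα ?_
    intro a ha
    obtain ⟨ha, hJ⟩ := hL a ha
    simpa [Judgment.subst, Exp.subst, n, ha] using hJ
  | eq_conc hr _ ih =>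
    obtain ⟨Δ', hr', hR'⟩ := h.restrict hR hr
    simp only [Judgment.subst, n]
    exact .eq_conc hr' (ih hR')
  | eq_beta _ _ _ _ ihA ih ih₁ =>
    obtain ⟨L', hL⟩ := h.under_var hR @ih
    simp only [Judgment.subst, i]
    refine .eq_beta L' (ihA hR) ?_ (ih₁ hR)
    intro x hx
    obtain ⟨hx, hJ⟩ := hL x hx
    simpa [Judgment.subst, Exp.subst, i, hx] using hJ
  | eq_ext _ _ _ _ _ ihA ihM ihN ih =>
    obtain ⟨L', hL⟩ := h.under_var hR @ih
    refine .eq_ext L' (ihA hR) (ihM hR) (ihN hR) ?_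
    intro x hx
    obtain ⟨hx, hJ⟩ := hL x hx
    simpa [Judgment.subst, Exp.subst, i, hx] using hJ
  | eq_nm_beta _ hr _ ih =>
    obtain ⟨Δ', hr', hR'⟩ := h.restrict hR hr
    obtain ⟨L', hL⟩ := h.under_name hR' @ih
    simp only [Judgment.subst, n]
    refine .eq_nm_beta L' hr' ?_
    intro a ha
    obtain ⟨ha, hJ⟩ := hL a ha
    simpa [Judgment.subst, Exp.subst, n, ha] using hJ
  | eq_nm_eta _ hα _ ih =>
    obtain ⟨L', hL⟩ := h.under_name hR @ih
    refine .eq_nm_eta L' hα ?_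
    intro a ha
    obtain ⟨ha, hJ⟩ := hL a ha
    simpa [Judgment.subst, Exp.subst, NameRef.rename, n, ha] using hJ
  | eq_symm _ ih => exact .eq_symm (ih hR)
  | eq_trans _ _ ih₁ ih₂ => exact .eq_trans (ih₁ hR) (ih₂ hR)
  | eq_conv _ _ ih₁ ih₂ => exact .eq_conv (ih₁ hR) (ih₂ hR)

end

/-! ### Weakening -/

/-- `Δ` arises from `Γ` by inserting variables, and names that are fresh for what precedes them. -/
inductive Weakening : Ctx → Ctx → Prop
  | refl (Γ : Ctx) : Weakening Γ Γ
  | var {Γ Δ : Ctx} (x : Var) (A : Ty) (h : Weakening Γ Δ) : Weakening Γ (.var x A :: Δ)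
  | name {Γ Δ : Ctx} {a : Name} (α : NameType) (ha : ∀ β, Entry.name a β ∉ Δ)
      (h : Weakening Γ Δ) : Weakening Γ (.name a α :: Δ)
  | cons {Γ Δ : Ctx} (E : Entry) (h : Weakening Γ Δ) : Weakening (E :: Γ) (E :: Δ)

theorem Weakening.subset {Γ Δ : Ctx} (h : Weakening Γ Δ) : Γ ⊆ Δ := by
  induction h with
  | refl => exact List.Subset.refl _
  | var _ _ _ ih | name _ _ _ ih => exact List.subset_cons_of_subset _ ih
  | cons _ _ ih => exact List.cons_subset_cons _ ih

theorem Weakening.restrict {Γ Δ Γ' : Ctx} {b : Name} {β : NameType} (h : Weakening Γ Δ)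
    (hr : Restrict Γ b β Γ') : ∃ Δ', Restrict Δ b β Δ' ∧ Weakening Γ' Δ' := by
  induction h generalizing Γ' with
  | refl => exact ⟨_, hr, .refl _⟩
  | var x A _ ih =>
    obtain ⟨Δ', h₁, h₂⟩ := ih hr
    exact ⟨_, .var _ _ h₁, h₂⟩
  | @name Γ Δ a α ha _ ih =>
    obtain ⟨Δ', h₁, h₂⟩ := ih hr
    have hab : a ≠ b := fun e => ha β (e ▸ h₁.mem)
    exact ⟨_, .nm _ _ hab h₁, .name _ (fun γ hγ => ha γ (h₁.subset hγ)) h₂⟩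
  | cons E h ih =>
    cases hr with
    | id => exact ⟨_, .id _ _ _, h⟩
    | nm _ _ hab hr =>
      obtain ⟨Δ', h₁, h₂⟩ := ih hr
      exact ⟨_, .nm _ _ hab h₁, .cons _ h₂⟩
    | var _ _ hr =>
      obtain ⟨Δ', h₁, h₂⟩ := ih hr
      exact ⟨_, .var _ _ h₁, h₂⟩

theorem Weakening.isLiftableSubst (S : Sig) : IsLiftableSubst S .fvar id Weakening where
  lc _ := trivial
  var h hx := by simpa using .var_o (h.subset hx)
  name h ha := h.subset ha
  restrict h hr := h.restrict hr
  consVar h := ⟨∅, fun x _ => ⟨rfl, fun A => by simpa using h.cons (.var x A)⟩⟩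
  consName h := ⟨∅, fun a _ => ⟨rfl, fun α => h.cons (.name a α)⟩⟩

@[simp]
theorem Judgment.subst_id (J : Judgment) : J.subst .fvar id = J := by
  cases J <;> simp [Judgment.subst]

theorem Derives.weaken {S : Sig} (hS : SigWF S) {Γ Δ : Ctx} {J : Judgment} (hJ : Derives S Γ J)
    (h : Weakening Γ Δ) : Derives S Δ J := by
  simpa using hJ.subst hS (Weakening.isLiftableSubst S) h

/-! ### Substitution for one variable or name, and context conversion -/

/-- The closure of `R` under extension of both contexts by variables and names that `(σ, ρ)`
fixes. -/
inductive Lift (σ : Var → Tm) (ρ : Name → Name) (R : Ctx → Ctx → Prop) : Ctx → Ctx → Prop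
  | base {Γ Δ : Ctx} (h : R Γ Δ) : Lift σ ρ R Γ Δ
  | var {Γ Δ : Ctx} {x : Var} (A : Ty) (hx : σ x = .fvar x) (h : Lift σ ρ R Γ Δ) :
      Lift σ ρ R (.var x A :: Γ) (.var x (A.subst σ ρ) :: Δ)
  | name {Γ Δ : Ctx} {a : Name} (α : NameType) (ha : ρ a = a) (hΔ : ∀ β, Entry.name a β ∉ Δ)
      (h : Lift σ ρ R Γ Δ) : Lift σ ρ R (.name a α :: Γ) (.name a α :: Δ)

theorem IsSubst.lift {S : Sig} (hS : SigWF S) {σ : Var → Tm} {ρ : Name → Name}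
    {R : Ctx → Ctx → Prop} (h : IsSubst S σ ρ R)
    (hσ : ∃ F : Finset Var, ∀ x ∉ F, σ x = .fvar x) (hρ : ∃ F : Finset Name, ∀ a ∉ F, ρ a = a) :
    IsLiftableSubst S σ ρ (Lift σ ρ R) where
  lc := h.lc
  var {Γ Δ y B} hR hy := by
    induction hR with
    | base hR => exact h.var hR hy
    | @var Γ Δ x A hx _ ih =>
      rcases List.mem_cons.1 hy with hy | hy
      · cases hy
        rw [hx]
        exact .var_o (by simp)
      · exact (ih hy).weaken hS (.var _ _ (.refl _))
    | name α _ hΔ _ ih => exact (ih (by simpa using hy)).weaken hS (.name _ hΔ (.refl _))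
  name {Γ Δ a α} hR ha := by
    induction hR with
    | base hR => exact h.name hR ha
    | var _ _ _ ih => exact List.mem_cons_of_mem _ (ih (by simpa using ha))
    | name β hb _ _ ih =>
      rcases List.mem_cons.1 ha with ha | ha
      · cases ha
        simp [hb]
      · exact List.mem_cons_of_mem _ (ih ha)
  restrict {Γ Δ Γ' b β} hR hr := by
    induction hR generalizing Γ' with
    | base hR =>
      obtain ⟨Δ', h₁, h₂⟩ := h.restrict hR hr
      exact ⟨Δ', h₁, .base h₂⟩
    | var A _ _ ih =>
      cases hr with
      | var _ _ hr =>
        obtain ⟨Δ', h₁, h₂⟩ := ih hr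
        exact ⟨Δ', .var _ _ h₁, h₂⟩
    | @name Γ Δ a α ha hΔ hL ih =>
      cases hr with
      | id => exact ⟨Δ, by rw [ha]; exact .id _ _ _, hL⟩
      | nm _ _ hab hr =>
        obtain ⟨Δ', h₁, h₂⟩ := ih hr
        have hab : a ≠ ρ b := fun e => hΔ β (e ▸ h₁.mem)
        exact ⟨_, .nm _ _ hab h₁, .name _ ha (fun γ hγ => hΔ γ (h₁.subset hγ)) h₂⟩
  consVar hR := hσ.imp fun _ hF x hx => ⟨hF x hx, fun A => .var A (hF x hx) hR⟩
  consName {Γ Δ} hR := by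
    obtain ⟨F, hF⟩ := hρ
    obtain ⟨L, hL⟩ := exists_fresh_name Δ
    refine ⟨F ∪ L, fun a ha => ?_⟩
    simp only [Finset.mem_union, not_or] at ha
    exact ⟨hF a ha.1, fun α => .name α (hF a ha.1)
      (fun β hβ => (hL a ha.2).1 a β hβ rfl) hR⟩

/-- `(σ, ρ)` fixes everything that is mentioned in `Γ`. -/
structure Fixes (σ : Var → Tm) (ρ : Name → Name) (Γ : Ctx) : Prop where
  var : ∀ x A, Entry.var x A ∈ Γ → σ x = .fvar x ∧ A.subst σ ρ = A
  name : ∀ a α, Entry.name a α ∈ Γ → ρ a = a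

theorem Fixes.mono {σ : Var → Tm} {ρ : Name → Name} {Γ Γ' : Ctx} (h : Fixes σ ρ Γ)
    (hΓ : Γ' ⊆ Γ) : Fixes σ ρ Γ' :=
  ⟨fun x A hx => h.var x A (hΓ hx), fun a α ha => h.name a α (hΓ ha)⟩

theorem Fixes.restrict {σ : Var → Tm} {ρ : Name → Name} {Γ Γ' : Ctx} {b : Name} {β : NameType}
    (h : Fixes σ ρ Γ) (hr : Restrict Γ b β Γ') : Restrict Γ (ρ b) β Γ' ∧ Fixes σ ρ Γ' := by
  rw [h.name b β hr.mem]
  exact ⟨hr, h.mono hr.subset⟩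

/-- Substitution for a variable that occurs nowhere else in the context. The underlying `IsSubst`
relation is the identity once a restriction has removed the variable. -/
theorem Derives.subst_var {S : Sig} (hS : SigWF S) {Γ : Ctx} {x : Var} {A : Ty} {N : Tm}
    {J : Judgment} (hJ : Derives S (.var x A :: Γ) J) (hN : Derives S Γ (.obj N A))
    (hx : ∀ y B, Entry.var y B ∈ Γ → y ≠ x ∧ x ∉ B.fv) (hA : x ∉ A.fv) :
    Derives S Γ (J.subst (Function.update .fvar x N) id) := by
  set σ : Var → Tm := Function.update .fvar x N with hσ
  have hfix {c : Cls} {e : Exp c} (he : x ∉ e.fv) : e.subst σ id = e :=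
    Exp.subst_eq_self (fun y hy => Function.update_of_ne (by rintro rfl; exact he hy) _ _)
      fun _ _ => rfl
  have hΓ : Fixes σ id Γ :=
    ⟨fun y B hy => ⟨Function.update_of_ne (hx y B hy).1 _ _, hfix (hx y B hy).2⟩, fun _ _ _ => rfl⟩
  have h : IsSubst S σ id
      fun G D => (G = .var x A :: Γ ∧ D = Γ) ∨ (G = D ∧ Fixes σ id G) :=
    { lc := fun y => by
        by_cases hy : y = x
        · subst hy
          simpa [hσ] using hN.scopedIn.lc
        · simp [hσ, hy, Exp.LC]
      var := by
        rintro G D y B (⟨rfl, rfl⟩ | ⟨rfl, hG⟩) hy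
        · rcases List.mem_cons.1 hy with hy | hy
          · cases hy
            rw [hfix hA]
            simpa [hσ] using hN
          · rw [(hΓ.var y B hy).1, (hΓ.var y B hy).2]
            exact .var_o hy
        · rw [(hG.var y B hy).1, (hG.var y B hy).2]
          exact .var_o hy
      name := by
        rintro G D a α (⟨rfl, rfl⟩ | ⟨rfl, hG⟩) ha
        · simpa using ha
        · exact ha
      restrict := by
        rintro G D Γ' b β (⟨rfl, rfl⟩ | ⟨rfl, hG⟩) hr
        · cases hr with
          | var _ _ hr => exact ⟨Γ', hr, .inr ⟨rfl, hΓ.mono hr.subset⟩⟩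
        · exact ⟨Γ', hr, .inr ⟨rfl, hG.mono hr.subset⟩⟩ }
  exact hJ.subst hS (h.lift hS ⟨{x}, fun y hy => Function.update_of_ne (by simpa using hy) _ _⟩
    ⟨∅, fun _ _ => rfl⟩) (.base (.inl ⟨rfl, rfl⟩))

/-- Replacing a bound name by a name `b` of the context, where the premise lives in the
restriction `Γ'` of `Γ` by `b`. Restricting `Γ' # a` by a name other than `a` leads to a pair of
contexts of the same shape, since restrictions commute; restricting by `a` leads to the identity
on `Γ'`. -/
theorem Derives.subst_name {S : Sig} (hS : SigWF S) {Γ Γ' : Ctx} {a b : Name} {α : NameType}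
    {J : Judgment} (hJ : Derives S (.name a α :: Γ') J) (hr : Restrict Γ b α Γ')
    (hb : ∀ β, Entry.name b β ∉ Γ') (ha : ∀ c γ, Entry.name c γ ∈ Γ' → c ≠ a)
    (haΓ : ∀ y B, Entry.var y B ∈ Γ' → a ∉ B.fn) :
    Derives S Γ (J.subst .fvar (Function.update id a b)) := by
  set ρ : Name → Name := Function.update id a b with hρ
  have hΓ : Fixes .fvar ρ Γ' :=
    ⟨fun y B hy => ⟨rfl, Exp.subst_eq_self (fun _ _ => rfl) fun c hc =>
      Function.update_of_ne (by rintro rfl; exact haΓ y B hy hc) _ _⟩,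
     fun c γ hc => Function.update_of_ne (ha c γ hc) _ _⟩
  have hab : ρ a = b := by simp [hρ]
  have h : IsSubst S .fvar ρ fun G D =>
      (∃ G', G = .name a α :: G' ∧ Restrict D b α G' ∧ (∀ β, Entry.name b β ∉ G') ∧
        Fixes .fvar ρ G') ∨ (G = D ∧ Fixes .fvar ρ G) :=
    { lc := fun _ => trivial
      var := by
        rintro G D y B (⟨G', rfl, hD, -, hG⟩ | ⟨rfl, hG⟩) hy
        · have hy : Entry.var y B ∈ G' := by simpa using hy
          rw [(hG.var y B hy).2]
          exact .var_o (hD.subset hy)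
        · rw [(hG.var y B hy).2]
          exact .var_o hy
      name := by
        rintro G D c γ (⟨G', rfl, hD, -, hG⟩ | ⟨rfl, hG⟩) hc
        · rcases List.mem_cons.1 hc with hc | hc
          · cases hc
            rw [hab]
            exact hD.mem
          · rw [hG.name c γ hc]
            exact hD.subset hc
        · rwa [hG.name c γ hc]
      restrict := by
        rintro G D G'' c γ (⟨G', rfl, hD, hb, hG⟩ | ⟨rfl, hG⟩) hr
        · cases hr with
          | id => exact ⟨_, by rwa [hab], .inr ⟨rfl, hG⟩⟩
          | nm _ _ _ hr =>
            rw [hG.name c γ hr.mem]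
            have hbc : b ≠ c := fun e => hb γ (e ▸ hr.mem)
            obtain ⟨D', h₁, h₂⟩ := hD.swap hr hbc
            exact ⟨D', h₁, .inl ⟨_, rfl, h₂, fun β h => hb β (hr.subset h), hG.mono hr.subset⟩⟩
        · exact ⟨G'', (hG.restrict hr).1, .inr ⟨rfl, (hG.restrict hr).2⟩⟩ }
  exact hJ.subst hS (h.lift hS ⟨∅, fun _ _ => rfl⟩
    ⟨{a}, fun c hc => Function.update_of_ne (by simpa using hc) _ _⟩)
    (.base (.inl ⟨Γ', rfl, hr, hb, hΓ⟩))

/-- Context conversion: the type of the last variable may be replaced by an equal one. -/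
theorem Derives.conv_ctx {S : Sig} (hS : SigWF S) {Γ : Ctx} {x : Var} {A B : Ty}
    {J : Judgment} (hJ : Derives S (.var x A :: Γ) J) (hAB : Derives S Γ (.famEq B A .type)) :
    Derives S (.var x B :: Γ) J := by
  have h : IsSubst S .fvar id
      fun G D => (G = .var x A :: Γ ∧ D = .var x B :: Γ) ∨ G = D :=
    { lc := fun _ => trivial
      var := by
        rintro G D y C (⟨rfl, rfl⟩ | rfl) hy
        · rw [Exp.subst_id]
          rcases List.mem_cons.1 hy with hy | hy
          · cases hy
            exact .conv_o (.var_o (by simp)) (hAB.weaken hS (.var _ _ (.refl _)))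
          · exact .var_o (List.mem_cons_of_mem _ hy)
        · rw [Exp.subst_id]
          exact .var_o hy
      name := by
        rintro G D a α (⟨rfl, rfl⟩ | rfl) ha
        · simpa using ha
        · exact ha
      restrict := by
        rintro G D Γ' b β (⟨rfl, rfl⟩ | rfl) hr
        · cases hr with
          | var _ _ hr => exact ⟨Γ', .var _ _ hr, .inr rfl⟩
        · exact ⟨Γ', hr, .inr rfl⟩ }
  simpa using hJ.subst hS (h.lift hS ⟨∅, fun _ _ => rfl⟩ ⟨∅, fun _ _ => rfl⟩)
    (.base (.inl ⟨rfl, rfl⟩))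

theorem Exp.subst_inst_of_notMem {c : Cls} {x : Var} {N : Tm} {e : Exp c} (hN : N.LC 0 0)
    (he : x ∉ e.fv) :
    (e.inst (.fvar x)).subst (Function.update .fvar x N) id = e.inst N := by
  have hlc (y : Var) : (Function.update Exp.fvar x N y).LC 0 0 := by
    by_cases hy : y = x
    · subst hy
      simpa using hN
    · simp [hy, Exp.LC]
  have he' : e.subst (Function.update .fvar x N) id = e :=
    Exp.subst_eq_self (fun y hy => Function.update_of_ne (by rintro rfl; exact he hy) _ _)
      fun _ _ => rfl
  rw [Exp.inst, Exp.subst_openVarAt _ hlc, he']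
  simp [Exp.subst]

theorem Exp.subst_instName_of_notMem {c : Cls} {a b : Name} {e : Exp c} (he : a ∉ e.fn) :
    (e.instName a).subst .fvar (Function.update id a b) = e.instName b := by
  have he' : e.subst .fvar (Function.update id a b) = e :=
    Exp.subst_eq_self (fun _ _ => rfl) fun c hc =>
      Function.update_of_ne (by rintro rfl; exact he hc) _ _
  rw [Exp.instName, Exp.subst_openNameAt (σ := .fvar) _ (fun _ => trivial), he']
  simp

section

variable {S : Sig} {Γ Γ' : Ctx} {α : NameType} {b : Name} {A B B' : Ty} {M N : Tm}

theorem Derives.obj_inst (hS : SigWF S) {L : Finset Var}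
    (h : ∀ x ∉ L, Derives S (.var x A :: Γ) (.obj (M.inst (.fvar x)) (B.inst (.fvar x))))
    (hN : Derives S Γ (.obj N A)) : Derives S Γ (.obj (M.inst N) (B.inst N)) := by
  obtain ⟨F, hF⟩ := exists_fresh_var Γ
  obtain ⟨x, hx⟩ := Infinite.exists_notMem_finset (L ∪ F ∪ A.fv ∪ M.fv ∪ B.fv)
  simp only [Finset.mem_union, not_or] at hx
  obtain ⟨⟨⟨⟨hL, hxF⟩, hA⟩, hM⟩, hB⟩ := hx
  have := (h x hL).subst_var hS hN (hF x hxF) hA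
  rwa [Judgment.subst, Exp.subst_inst_of_notMem hN.scopedIn.lc hM,
    Exp.subst_inst_of_notMem hN.scopedIn.lc hB] at this

theorem Derives.famEq_inst (hS : SigWF S) {L : Finset Var}
    (h : ∀ x ∉ L, Derives S (.var x A :: Γ)
      (.famEq (B.inst (.fvar x)) (B'.inst (.fvar x)) .type))
    (hN : Derives S Γ (.obj N A)) : Derives S Γ (.famEq (B.inst N) (B'.inst N) .type) := by
  obtain ⟨F, hF⟩ := exists_fresh_var Γ
  obtain ⟨x, hx⟩ := Infinite.exists_notMem_finset (L ∪ F ∪ A.fv ∪ B.fv ∪ B'.fv)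
  simp only [Finset.mem_union, not_or] at hx
  obtain ⟨⟨⟨⟨hL, hxF⟩, hA⟩, hB⟩, hB'⟩ := hx
  have := (h x hL).subst_var hS hN (hF x hxF) hA
  rwa [Judgment.subst, Exp.subst_inst_of_notMem hN.scopedIn.lc hB,
    Exp.subst_inst_of_notMem hN.scopedIn.lc hB'] at this

theorem Derives.obj_instName (hS : SigWF S) (hr : Restrict Γ b α Γ')
    (hb : ∀ β, Entry.name b β ∉ Γ') {L : Finset Name}
    (h : ∀ a ∉ L, Derives S (.name a α :: Γ') (.obj (M.instName a) (B.instName a))) :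
    Derives S Γ (.obj (M.instName b) (B.instName b)) := by
  obtain ⟨F, hF⟩ := exists_fresh_name Γ'
  obtain ⟨a, ha⟩ := Infinite.exists_notMem_finset (L ∪ F ∪ M.fn ∪ B.fn)
  simp only [Finset.mem_union, not_or] at ha
  obtain ⟨⟨⟨hL, haF⟩, hM⟩, hB⟩ := ha
  have := (h a hL).subst_name hS hr hb (hF a haF).1 (hF a haF).2
  rwa [Judgment.subst, Exp.subst_instName_of_notMem hM, Exp.subst_instName_of_notMem hB] at this

theorem Derives.famEq_instName (hS : SigWF S) (hr : Restrict Γ b α Γ')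
    (hb : ∀ β, Entry.name b β ∉ Γ') {L : Finset Name}
    (h : ∀ a ∉ L, Derives S (.name a α :: Γ')
      (.famEq (B.instName a) (B'.instName a) .type)) :
    Derives S Γ (.famEq (B.instName b) (B'.instName b) .type) := by
  obtain ⟨F, hF⟩ := exists_fresh_name Γ'
  obtain ⟨a, ha⟩ := Infinite.exists_notMem_finset (L ∪ F ∪ B.fn ∪ B'.fn)
  simp only [Finset.mem_union, not_or] at ha
  obtain ⟨⟨⟨hL, haF⟩, hB⟩, hB'⟩ := ha
  have := (h a hL).subst_name hS hr hb (hF a haF).1 (hF a haF).2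
  rwa [Judgment.subst, Exp.subst_instName_of_notMem hB, Exp.subst_instName_of_notMem hB'] at this

end

/-! ### Injectivity of `Π` and `и` -/

/-- `A` is not formed by `Π` or `и`. -/
def NotBinder (A : Ty) : Prop :=
  (∀ A₁ A₂, A ≠ .pi A₁ A₂) ∧ ∀ α B, A ≠ .new α B

/-- `A` and `B` are both `Π`-types with equal components, or both `и`-types with equal components,
or neither of them is a `Π`-type or `и`-type. -/
inductive HeadEq (S : Sig) (Γ : Ctx) : Ty → Ty → Prop
  | pi {A₁ A₂ B₁ B₂ : Ty} (L : Finset Var) (h₁ : Derives S Γ (.famEq A₁ B₁ .type))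
      (h₂ : ∀ x ∉ L, Derives S (.var x A₁ :: Γ)
        (.famEq (A₂.inst (.fvar x)) (B₂.inst (.fvar x)) .type)) :
      HeadEq S Γ (.pi A₁ A₂) (.pi B₁ B₂)
  | new {α : NameType} {A B : Ty} (L : Finset Name)
      (h : ∀ a ∉ L, Derives S (.name a α :: Γ)
        (.famEq (A.instName a) (B.instName a) .type)) :
      HeadEq S Γ (.new α A) (.new α B)
  | other {A B : Ty} (hA : NotBinder A) (hB : NotBinder B) : HeadEq S Γ A B

theorem HeadEq.symm {S : Sig} (hS : SigWF S) {Γ : Ctx} {A B : Ty} (h : HeadEq S Γ A B) :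
    HeadEq S Γ B A := by
  cases h with
  | pi L h₁ h₂ =>
    exact .pi L (.eq_symm_t h₁) fun x hx =>
      (Derives.eq_symm_t (h₂ x hx)).conv_ctx hS (.eq_symm_t h₁)
  | new L h => exact .new L fun a ha => .eq_symm_t (h a ha)
  | other hA hB => exact .other hB hA

theorem HeadEq.trans {S : Sig} (hS : SigWF S) {Γ : Ctx} {A B C : Ty} (h : HeadEq S Γ A B)
    (h' : HeadEq S Γ B C) : HeadEq S Γ A C := by
  cases h with
  | pi L h₁ h₂ =>
    cases h' with
    | pi L' h₁' h₂' =>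
      refine .pi (L ∪ L') (.eq_trans_t h₁ h₁') fun x hx => ?_
      simp only [Finset.mem_union, not_or] at hx
      exact .eq_trans_t (h₂ x hx.1) ((h₂' x hx.2).conv_ctx hS h₁)
    | other hB => exact absurd rfl (hB.1 _ _)
  | new L h =>
    cases h' with
    | new L' h' =>
      refine .new (L ∪ L') fun a ha => ?_
      simp only [Finset.mem_union, not_or] at ha
      exact .eq_trans_t (h a ha.1) (h' a ha.2)
    | other hB => exact absurd rfl (hB.2 _ _)
  | other hA hB =>
    cases h' with
    | pi => exact absurd rfl (hB.1 _ _)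
    | new => exact absurd rfl (hB.2 _ _)
    | other _ hC => exact .other hA hC

/-- The invariant by which injectivity is proved. Only equalities at the kind `type` carry
information, which disposes of the extensionality rule for families; kind equality is tracked
because the conversion rule must not lead from another kind to `type`. -/
def Judgment.HeadEqIn (S : Sig) (Γ : Ctx) : Judgment → Prop
  | .famEq A B K => K = .type → HeadEq S Γ A B
  | .kindEq K K' => K = .type ↔ K' = .type
  | .kind _ | .fam _ _ | .obj _ _ | .objEq _ _ _ => True

theorem Derives.headEqIn {S : Sig} (hS : SigWF S) {Γ : Ctx} {J : Judgment} (h : Derives S Γ J) :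
    J.HeadEqIn S Γ := by
  induction h with
  | eq_type_k => exact Iff.rfl
  | eq_pi_k => simp [Judgment.HeadEqIn]
  | eq_symm_k _ ih => exact ih.symm
  | eq_trans_k _ _ ih₁ ih₂ => exact ih₁.trans ih₂
  | eq_con_t | eq_app_t | eq_nm_t =>
    exact fun _ => .other (by simp [NotBinder]) (by simp [NotBinder])
  | eq_pi_t L h₁ _ h₂ => exact fun _ => .pi L h₁ h₂
  | eq_new_t L _ h => exact fun _ => .new L h
  | eq_ext_t => simp [Judgment.HeadEqIn]
  | eq_symm_t _ ih => exact fun hK => (ih hK).symm hS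
  | eq_trans_t _ _ ih₁ ih₂ => exact fun hK => (ih₁ hK).trans hS (ih₂ hK)
  | eq_conv_t _ _ ih₁ ih₂ => exact fun hK => ih₁ (ih₂.2 hK)
  | _ => trivial

/-! ### Inversion of typing -/

/-- Definitional equality of types, closed under syntactic identity. (Definitional equality is
reflexive only on well-formed types.) -/
def TyConv (S : Sig) (Γ : Ctx) (A B : Ty) : Prop :=
  A = B ∨ Derives S Γ (.famEq A B .type)

section

variable {S : Sig} {Γ : Ctx} {A B C : Ty} {M N : Tm}

theorem TyConv.trans_famEq (h : TyConv S Γ A B) (h' : Derives S Γ (.famEq B C .type)) :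
    TyConv S Γ A C := by
  rcases h with rfl | h
  · exact .inr h'
  · exact .inr (.eq_trans_t h h')

theorem Derives.conv (h : Derives S Γ (.obj M A)) (hAB : TyConv S Γ A B) :
    Derives S Γ (.obj M B) := by
  rcases hAB with rfl | hAB
  · exact h
  · exact .conv_o h hAB

theorem Derives.conv_eq (h : Derives S Γ (.objEq M N A)) (hAB : TyConv S Γ A B) :
    Derives S Γ (.objEq M N B) := by
  rcases hAB with rfl | hAB
  · exact h
  · exact .eq_conv h hAB

theorem Derives.app_inv (h : Derives S Γ (.obj (.app M N) C)) :
    ∃ A B, Derives S Γ (.obj M (.pi A B)) ∧ Derives S Γ (.obj N A) ∧ TyConv S Γ (B.inst N) C := by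
  generalize hJ : Judgment.obj (.app M N) C = J at h
  induction h generalizing C with
  | app_o hM hN =>
    cases hJ
    exact ⟨_, _, hM, hN, .inl rfl⟩
  | conv_o _ hAB ih =>
    cases hJ
    obtain ⟨A, B, hM, hN, hC⟩ := ih rfl
    exact ⟨A, B, hM, hN, hC.trans_famEq hAB⟩
  | _ => cases hJ

theorem Derives.lam_inv (h : Derives S Γ (.obj (.lam A M) C)) :
    ∃ (B : Ty) (L : Finset Var), Derives S Γ (.fam A .type) ∧
      (∀ x ∉ L, Derives S (.var x A :: Γ) (.obj (M.inst (.fvar x)) (B.inst (.fvar x)))) ∧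
      TyConv S Γ (.pi A B) C := by
  generalize hJ : Judgment.obj (.lam A M) C = J at h
  induction h generalizing C with
  | lam_o L hA hM =>
    cases hJ
    exact ⟨_, L, hA, hM, .inl rfl⟩
  | conv_o _ hAB ih =>
    cases hJ
    obtain ⟨B, L, hA, hM, hC⟩ := ih rfl
    exact ⟨B, L, hA, hM, hC.trans_famEq hAB⟩
  | _ => cases hJ

theorem Derives.conc_inv {b : Name} (h : Derives S Γ (.obj (.conc M (.free b)) C)) :
    ∃ Γ' α B, Restrict Γ b α Γ' ∧ Derives S Γ' (.obj M (.new α B)) ∧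
      TyConv S Γ (B.instName b) C := by
  generalize hJ : Judgment.obj (.conc M (.free b)) C = J at h
  induction h generalizing C with
  | conc_o hr hM =>
    cases hJ
    exact ⟨_, _, _, hr, hM, .inl rfl⟩
  | conv_o _ hAB ih =>
    cases hJ
    obtain ⟨Γ', α, B, hr, hM, hC⟩ := ih rfl
    exact ⟨Γ', α, B, hr, hM, hC.trans_famEq hAB⟩
  | _ => cases hJ

theorem Derives.abs_inv {α : NameType} (h : Derives S Γ (.obj (.abs α M) C)) :
    ∃ (B : Ty) (L : Finset Name),
      (∀ a ∉ L, Derives S (.name a α :: Γ) (.obj (M.instName a) (B.instName a))) ∧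
      TyConv S Γ (.new α B) C := by
  generalize hJ : Judgment.obj (.abs α M) C = J at h
  induction h generalizing C with
  | abs_o L _ hM =>
    cases hJ
    exact ⟨_, L, hM, .inl rfl⟩
  | conv_o _ hAB ih =>
    cases hJ
    obtain ⟨B, L, hM, hC⟩ := ih rfl
    exact ⟨B, L, hM, hC.trans_famEq hAB⟩
  | _ => cases hJ

/-- Inversion of a typed `λ`-abstraction at a given `Π`-type. Injectivity of `Π` enters here: it
lets an argument for the given type be used for the annotated domain. -/
theorem Derives.lam_inv_pi (hS : SigWF S) {A₁ B₁ : Ty}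
    (h : Derives S Γ (.obj (.lam A M) (.pi A₁ B₁))) :
    ∃ (B : Ty) (L : Finset Var), Derives S Γ (.fam A .type) ∧
      (∀ x ∉ L, Derives S (.var x A :: Γ) (.obj (M.inst (.fvar x)) (B.inst (.fvar x)))) ∧
      ∀ N, Derives S Γ (.obj N A₁) →
        Derives S Γ (.obj N A) ∧ TyConv S Γ (B.inst N) (B₁.inst N) := by
  obtain ⟨B, L, hA, hM, h⟩ := h.lam_inv
  rcases h with h | h
  · cases h
    exact ⟨_, L, hA, hM, fun N hN => ⟨hN, .inl rfl⟩⟩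
  · refine ⟨B, L, hA, hM, fun N hN => ?_⟩
    cases h.headEqIn hS rfl with
    | pi L' h₁ h₂ =>
      have hN := hN.conv_o (.eq_symm_t h₁)
      exact ⟨hN, .inr (.famEq_inst hS h₂ hN)⟩
    | other h => exact absurd rfl (h.1 _ _)

/-- Inversion of a typed name-abstraction at a given `и`-type; the conclusion on types is given
after instantiation by a name `b` whose restriction yields the ambient context. -/
theorem Derives.abs_inv_new (hS : SigWF S) {α β : NameType} {B₁ : Ty}
    (h : Derives S Γ (.obj (.abs α M) (.new β B₁))) :
    α = β ∧ ∃ (B : Ty) (L : Finset Name),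
      (∀ a ∉ L, Derives S (.name a α :: Γ) (.obj (M.instName a) (B.instName a))) ∧
      ∀ Δ b, Restrict Δ b α Γ → (∀ β, Entry.name b β ∉ Γ) →
        TyConv S Δ (B.instName b) (B₁.instName b) := by
  obtain ⟨B, L, hM, h⟩ := h.abs_inv
  rcases h with h | h
  · cases h
    exact ⟨rfl, _, L, hM, fun _ _ _ _ => .inl rfl⟩
  · cases h.headEqIn hS rfl with
    | new L' h =>
      exact ⟨rfl, B, L, hM, fun Δ b hr hb => .inr (.famEq_instName hS hr hb h)⟩
    | other h => exact absurd rfl (h.2 _ _)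

end

/-! ### Subject reduction -/

/-- Only distinctness of names is asked of the context, so that the induction passes through the
restricted contexts of the concretion rule. -/
theorem subject_reduction {S : Sig} (hS : SigWF S) {Γ : Ctx} (hΓ : DistinctNames Γ) {M M' : Tm}
    {C : Ty} (hM : Derives S Γ (.obj M C)) (hred : WHR M M') :
    Derives S Γ (.objEq M M' C) ∧ Derives S Γ (.obj M' C) := by
  induction hred generalizing Γ C with
  | app N _ ih =>
    obtain ⟨A, B, hM, hN, hC⟩ := hM.app_inv
    obtain ⟨h₁, h₂⟩ := ih hΓ hM
    exact ⟨(Derives.eq_app h₁ hN.refl).conv_eq hC, (Derives.app_o h₂ hN).conv hC⟩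
  | beta A M N =>
    obtain ⟨A₁, B₁, hlam, hN, hC⟩ := hM.app_inv
    obtain ⟨B, L, hA, hM, hconv⟩ := hlam.lam_inv_pi hS
    obtain ⟨hN, hB⟩ := hconv N hN
    exact ⟨((Derives.eq_beta L hA (fun x hx => (hM x hx).refl) hN.refl).conv_eq hB).conv_eq hC,
      ((Derives.obj_inst hS hM hN).conv hB).conv hC⟩
  | conc a _ ih =>
    obtain ⟨Γ', α, B, hr, hM, hC⟩ := hM.conc_inv
    obtain ⟨h₁, h₂⟩ := ih (hΓ.restrict hr) hM
    exact ⟨(Derives.eq_conc hr h₁).conv_eq hC, (Derives.conc_o hr h₂).conv hC⟩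
  | nm_beta α M b =>
    obtain ⟨Γ', β, B₁, hr, habs, hC⟩ := hM.conc_inv
    obtain ⟨rfl, B, L, hM, hconv⟩ := habs.abs_inv_new hS
    have hb := hΓ.notMem_restrict hr
    have hB := hconv Γ b hr hb
    exact ⟨((Derives.eq_nm_beta L hr fun a ha => (hM a ha).refl).conv_eq hB).conv_eq hC,
      ((Derives.obj_instName hS hr hb hM).conv hB).conv hC⟩

end NomLF

theorem mainTheorem8 (S : NomLF.Sig) (hS : NomLF.SigWF S)
    (Γ : NomLF.Ctx) (hΓ : NomLF.CtxWF S Γ)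
    (M M' : NomLF.Tm) (A : NomLF.Ty)
    (hM : NomLF.Derives S Γ (.obj M A)) (hred : NomLF.WHR M M') :
    NomLF.Derives S Γ (.objEq M M' A) ∧ NomLF.Derives S Γ (.obj M' A) :=
  NomLF.subject_reduction hS hΓ.distinctNames hM hred
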